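/- Let $\mathbb S^3(\sqrt2)\subset\mathbb R^4$ and $\mathbb S^2(\tfrac1{\sqrt2})\subset\mathbb R^3$ be the round spheres of radii $\sqrt2$ and $\tfrac1{\sqrt2}$ centred at the origin, with the induced metrics, and let $\psi:\mathbb S^3(\sqrt2)\to\mathbb S^2(\tfrac1{\sqrt2})$, $$\psi(z,w)=\tfrac{1}{2\sqrt2}\big(2z\overline w,\ |z|^2-|w|^2\big),\qquad z=x^1+\mathrm i x^2,\ w=x^3+\mathrm i x^4,$$ be the Hopf map. On $\mathbb S^3(\sqrt2)$ consider the vector fields $$X_2(x)=\tfrac1{\sqrt2}(-x^3,x^4,x^1,-x^2),\qquad X_3(x)=\tfrac1{\sqrt2}(-x^4,-x^3,x^2,x^1).$$ Let $\Delta=-\operatorname{trace}\nabla^2$ be the Laplacian on functions on $\mathbb S^3(\sqrt2)$ and, for $k\in\mathbb N=\{0,1,2,\dots\}$, let $\lambda_k=\tfrac{k(k+2)}2$ (its eigenvalues). Let $J^\psi(V)=\Delta^\psi V+\operatorname{trace}R^{\mathbb S^2(1/\sqrt2)}(d\psi\,\cdot,V)\,d\psi\,\cdot$ be the Jacobi operator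 of $\psi$ acting on smooth sections $V$ of $\psi^{-1}T\mathbb S^2(\tfrac1{\sqrt2})$, where $\Delta^\psi=-\operatorname{trace}(\nabla^\psi)^2$ and $R(X,Y)=[\nabla_X,\nabla_Y]-\nabla_{[X,Y]}$. A smooth vector field $X$ on $\mathbb S^3(\sqrt2)$ is called basic if it is horizontal, i.e. $X(p)\perp\ker d\psi_p$ for all $p$, and $\psi$-related to a smooth vector field $Y$ on $\mathbb S^2(\tfrac1{\sqrt2})$, i.e. $d\psi_p(X(p))=Y(\psi(p))$ for all $p$. **Proposition 4.7.** Let $k\in\mathbb N$, let $f_2,f_3\in C^\infty(\mathbb S^3(\sqrt2))$ satisfy $\Delta f_2=\lambda_kf_2$ and $\Delta f_3=\lambda_kf_3$ (one of them may vanish identically), and suppose that $X=f_2X_2+f_3X_3$ is not identically zero. Then $d\psi(X)\in\ker J^\psi$ if and only if either $k=0$, or $k=2$ and $X$ is basic. -/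

import Mathlib

open scoped ContDiff

noncomputable section

namespace HopfJacobi

/-! Geometry of round spheres `Metric.sphere (0 : E) r` in a Euclidean space `E`, with the metric
induced from `E`: tangent spaces, smooth maps, differentials, Levi-Civita and pull-back
connections, Laplacians, curvature, and the Jacobi operator of a map between two spheres. -/

section Sphere

/-- The tangent space at `p` of the sphere centred at the origin through `p`: the orthogonal
complement of the radial direction. -/
abbrev Tan {E : Type*} [NormedAddCommGroup E] [InnerProductSpace ℝ E] {r : ℝ}
    (p : Metric.sphere (0 : E) r) : Submodule ℝ E :=
  (ℝ ∙ (p : E))ᗮ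

/-- The extension of a map defined on a sphere to the punctured ambient space, constant on the rays
from the origin, that is, the composition with the smooth retraction `x ↦ (r / ‖x‖) • x`.
(The value at the origin is irrelevant.) -/
def radialExt {E G : Type*} [NormedAddCommGroup E] [InnerProductSpace ℝ E] [Zero G] {r : ℝ}
    (f : Metric.sphere (0 : E) r → G) (x : E) : G :=
  Function.extend Subtype.val f 0 ((r / ‖x‖) • x)

/-- A vector-valued map on a sphere is smooth if its composition with the smooth retraction of the
punctured ambient space onto the sphere is smooth. Since the retraction restricts to the identity
of the sphere, this is smoothness for the usual submanifold structure. -/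
def IsSmooth {E G : Type*} [NormedAddCommGroup E] [InnerProductSpace ℝ E] [NormedAddCommGroup G]
    [NormedSpace ℝ G] {r : ℝ} (f : Metric.sphere (0 : E) r → G) : Prop :=
  ContDiffOn ℝ ∞ (radialExt f) {0}ᶜ

/-- The derivative at `p` of a vector-valued map on a sphere, along tangent vectors at `p`. -/
def dirDeriv {E G : Type*} [NormedAddCommGroup E] [InnerProductSpace ℝ E] [NormedAddCommGroup G]
    [NormedSpace ℝ G] {r : ℝ} (f : Metric.sphere (0 : E) r → G) (p : Metric.sphere (0 : E) r) :
    Tan p →ₗ[ℝ] G :=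
  (fderiv ℝ (radialExt f) (p : E) : E →ₗ[ℝ] G) ∘ₗ (Tan p).subtype

theorem radialExt_coe {E G : Type*} [NormedAddCommGroup E] [InnerProductSpace ℝ E] [Zero G] {r : ℝ}
    (f : Metric.sphere (0 : E) r → G) (p : Metric.sphere (0 : E) r) :
    radialExt f (p : E) = f p := by
  have hp : ‖(p : E)‖ = r := by simp
  have h : (r / ‖(p : E)‖) • (p : E) = p := by
    by_cases h0 : r = 0
    · have : (p : E) = 0 := by rw [← norm_eq_zero, hp, h0]
      simp [this]
    · rw [hp, div_self h0, one_smul]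
  rw [radialExt, h, Subtype.val_injective.extend_apply]

/-- The derivative of a map between spheres takes values in the tangent space of the target. -/
theorem dirDeriv_mem_tan {E F : Type*} [NormedAddCommGroup E] [InnerProductSpace ℝ E]
    [NormedAddCommGroup F] [InnerProductSpace ℝ F] {r s : ℝ}
    (φ : Metric.sphere (0 : E) r → Metric.sphere (0 : F) s) (p : Metric.sphere (0 : E) r)
    (v : Tan p) : dirDeriv (fun q => (φ q : F)) p v ∈ Tan (φ p) := by
  set g : E → F := radialExt (fun q => (φ q : F)) with hg
  have hr : ‖(p : E)‖ = r := by simp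
  have hgp : g p = φ p := radialExt_coe _ p
  have hconst : ∀ᶠ x in nhds (p : E), ‖g x‖ ^ 2 = s ^ 2 := by
    have key : ∀ x : E, ‖x‖ ≠ 0 ∨ r = 0 → ‖g x‖ ^ 2 = s ^ 2 := by
      intro x hx
      have hm : (r / ‖x‖) • x ∈ Metric.sphere (0 : E) r := by
        have hr0 : 0 ≤ r := hr ▸ norm_nonneg _
        rcases hx with hx | hx
        · simp [norm_smul, abs_of_nonneg hr0, div_mul_cancel₀ _ hx]
        · simp [hx]
      have : g x = φ ⟨_, hm⟩ := by
        rw [hg, radialExt]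
        exact Subtype.val_injective.extend_apply (fun q => (φ q : F)) 0 ⟨_, hm⟩
      have h2 := (φ ⟨_, hm⟩).2
      rw [this, mem_sphere_zero_iff_norm.1 h2]
    by_cases h0 : r = 0
    · exact Filter.Eventually.of_forall fun x => key x (Or.inr h0)
    · have hp0 : ‖(p : E)‖ ≠ 0 := by rw [hr]; exact h0
      filter_upwards [continuous_norm.continuousAt.eventually_ne hp0] with x hx
      exact key x (Or.inl hx)
  rw [Submodule.mem_orthogonal_singleton_iff_inner_right]
  change inner ℝ (φ p : F) (fderiv ℝ g p v) = 0
  by_cases hd : DifferentiableAt ℝ g (p : E)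
  · have h1 := hd.hasFDerivAt.norm_sq
    have h2 : HasFDerivAt (fun x => ‖g x‖ ^ 2) (0 : E →L[ℝ] ℝ) (p : E) :=
      (hasFDerivAt_const (s ^ 2) (p : E)).congr_of_eventuallyEq hconst
    have h3 := congrArg (fun L : E →L[ℝ] ℝ => L v) (h1.unique h2)
    simpa [hgp] using h3
  · simp [fderiv_zero_of_not_differentiableAt hd]

/-- The differential `dφ_p : T_p → T_{φ p}` of a map between spheres. -/
def differential {E F : Type*} [NormedAddCommGroup E] [InnerProductSpace ℝ E]
    [NormedAddCommGroup F] [InnerProductSpace ℝ F] {r s : ℝ}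
    (φ : Metric.sphere (0 : E) r → Metric.sphere (0 : F) s) (p : Metric.sphere (0 : E) r) :
    Tan p →ₗ[ℝ] Tan (φ p) :=
  (dirDeriv (fun q => (φ q : F)) p).codRestrict (Tan (φ p)) (dirDeriv_mem_tan φ p)

/-- The pull-back `∇^φ` to `φ⁻¹T` of the Levi-Civita connection of the target sphere: the tangential
part of the ambient derivative of the section `V` of `φ⁻¹T`. -/
def pullbackConn {E F : Type*} [NormedAddCommGroup E] [InnerProductSpace ℝ E]
    [NormedAddCommGroup F] [InnerProductSpace ℝ F] {r s : ℝ}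
    (φ : Metric.sphere (0 : E) r → Metric.sphere (0 : F) s) (V : ∀ q, Tan (φ q))
    (p : Metric.sphere (0 : E) r) (u : Tan p) : Tan (φ p) :=
  (Tan (φ p)).orthogonalProjectionOnto (dirDeriv (fun q => (V q : F)) p u)

/-- The Levi-Civita connection of a sphere. -/
def leviCivita {E : Type*} [NormedAddCommGroup E] [InnerProductSpace ℝ E] {r : ℝ}
    (Y : ∀ q : Metric.sphere (0 : E) r, Tan q) (p : Metric.sphere (0 : E) r) (u : Tan p) : Tan p :=
  pullbackConn id Y p u

/-- A smooth tangent vector field with the value `v` at the point where `v` is tangent: the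
tangential part of the constant field `v`. -/
def extendVec {E : Type*} [NormedAddCommGroup E] [InnerProductSpace ℝ E] {r : ℝ} (v : E)
    (q : Metric.sphere (0 : E) r) : Tan q :=
  (Tan q).orthogonalProjectionOnto v

/-- The second covariant derivative `(∇²f)(u, v) = U(Ũf) - (∇_u Ũ)f` of a function (its Hessian),
where `Ũ` is a vector field extending `v`. -/
def hessian {E : Type*} [NormedAddCommGroup E] [InnerProductSpace ℝ E] {r : ℝ}
    (f : Metric.sphere (0 : E) r → ℝ) (p : Metric.sphere (0 : E) r) (u v : Tan p) : ℝ :=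
  dirDeriv (fun q => dirDeriv f q (extendVec (v : E) q)) p u
    - dirDeriv f p (leviCivita (extendVec (v : E)) p u)

/-- The Laplace-Beltrami operator on functions, with the sign `Δ = -trace ∇²`. -/
def laplacian {E : Type*} [NormedAddCommGroup E] [InnerProductSpace ℝ E] [FiniteDimensional ℝ E]
    {r : ℝ} (f : Metric.sphere (0 : E) r → ℝ) (p : Metric.sphere (0 : E) r) : ℝ :=
  -∑ i, hessian f p (stdOrthonormalBasis ℝ (Tan p) i) (stdOrthonormalBasis ℝ (Tan p) i)

/-- The second covariant derivative `((∇^φ)²V)(u, v) = ∇^φ_u ∇^φ_Ũ V - ∇^φ_{∇_u Ũ} V` of a section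
`V` of `φ⁻¹T`, where `Ũ` is a vector field extending `v`. -/
def secondCovDeriv {E F : Type*} [NormedAddCommGroup E] [InnerProductSpace ℝ E]
    [NormedAddCommGroup F] [InnerProductSpace ℝ F] {r s : ℝ}
    (φ : Metric.sphere (0 : E) r → Metric.sphere (0 : F) s) (V : ∀ q, Tan (φ q))
    (p : Metric.sphere (0 : E) r) (u v : Tan p) : Tan (φ p) :=
  pullbackConn φ (fun q => pullbackConn φ V q (extendVec (v : E) q)) p u
    - pullbackConn φ V p (leviCivita (extendVec (v : E)) p u)

/-- The rough Laplacian `Δ^φ = -trace (∇^φ)²` on sections of `φ⁻¹T`. -/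
def roughLaplacian {E F : Type*} [NormedAddCommGroup E] [InnerProductSpace ℝ E]
    [FiniteDimensional ℝ E] [NormedAddCommGroup F] [InnerProductSpace ℝ F] {r s : ℝ}
    (φ : Metric.sphere (0 : E) r → Metric.sphere (0 : F) s) (V : ∀ q, Tan (φ q))
    (p : Metric.sphere (0 : E) r) : Tan (φ p) :=
  -∑ i, secondCovDeriv φ V p (stdOrthonormalBasis ℝ (Tan p) i) (stdOrthonormalBasis ℝ (Tan p) i)

/-- The Lie bracket of two tangent vector fields on a sphere. (The ambient bracket of the extended
fields is already tangent; the projection only records this in the type.) -/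
def lieBracket {E : Type*} [NormedAddCommGroup E] [InnerProductSpace ℝ E] {r : ℝ}
    (X Y : ∀ q : Metric.sphere (0 : E) r, Tan q) (p : Metric.sphere (0 : E) r) : Tan p :=
  (Tan p).orthogonalProjectionOnto
    (VectorField.lieBracket ℝ (radialExt fun q => (X q : E)) (radialExt fun q => (Y q : E)) p)

/-- `R(X, Y)Z = ∇_X ∇_Y Z - ∇_Y ∇_X Z - ∇_{[X,Y]} Z` for vector fields on a sphere. -/
def curvatureField {E : Type*} [NormedAddCommGroup E] [InnerProductSpace ℝ E] {r : ℝ}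
    (X Y Z : ∀ q : Metric.sphere (0 : E) r, Tan q) (p : Metric.sphere (0 : E) r) : Tan p :=
  leviCivita (fun q => leviCivita Z q (Y q)) p (X p)
    - leviCivita (fun q => leviCivita Z q (X q)) p (Y p)
    - leviCivita Z p (lieBracket X Y p)

/-- The curvature tensor `R_p(u, v)w` of a sphere at a point. -/
def curvature {E : Type*} [NormedAddCommGroup E] [InnerProductSpace ℝ E] {r : ℝ}
    (p : Metric.sphere (0 : E) r) (u v w : Tan p) : Tan p :=
  curvatureField (extendVec (u : E)) (extendVec (v : E)) (extendVec (w : E)) p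

/-- The Jacobi operator `J^φ(V) = Δ^φ V + trace R(dφ ·, V) dφ ·`. -/
def jacobiOperator {E F : Type*} [NormedAddCommGroup E] [InnerProductSpace ℝ E]
    [FiniteDimensional ℝ E] [NormedAddCommGroup F] [InnerProductSpace ℝ F] {r s : ℝ}
    (φ : Metric.sphere (0 : E) r → Metric.sphere (0 : F) s) (V : ∀ q, Tan (φ q))
    (p : Metric.sphere (0 : E) r) : Tan (φ p) :=
  roughLaplacian φ V p
    + ∑ i, curvature (φ p) (differential φ p (stdOrthonormalBasis ℝ (Tan p) i)) (V p)
        (differential φ p (stdOrthonormalBasis ℝ (Tan p) i))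

/-- The kernel of the Jacobi operator on the smooth sections of `φ⁻¹T`. -/
def jacobiKernel {E F : Type*} [NormedAddCommGroup E] [InnerProductSpace ℝ E]
    [FiniteDimensional ℝ E] [NormedAddCommGroup F] [InnerProductSpace ℝ F] {r s : ℝ}
    (φ : Metric.sphere (0 : E) r → Metric.sphere (0 : F) s) : Set (∀ q, Tan (φ q)) :=
  {V | IsSmooth (fun q => (V q : F)) ∧ ∀ p, jacobiOperator φ V p = 0}

/-- The horizontal space of `φ` at `p`: the orthogonal complement, in the tangent space, of the
vertical space `ker dφ_p`. -/
def horizontalSpace {E F : Type*} [NormedAddCommGroup E] [InnerProductSpace ℝ E]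
    [NormedAddCommGroup F] [InnerProductSpace ℝ F] {r s : ℝ}
    (φ : Metric.sphere (0 : E) r → Metric.sphere (0 : F) s) (p : Metric.sphere (0 : E) r) :
    Submodule ℝ (Tan p) :=
  (LinearMap.ker (differential φ p))ᗮ

/-- A smooth vector field `X` is basic for `φ` if it is horizontal and `φ`-related to a smooth
vector field on the target. -/
def IsBasic {E F : Type*} [NormedAddCommGroup E] [InnerProductSpace ℝ E]
    [NormedAddCommGroup F] [InnerProductSpace ℝ F] {r s : ℝ}
    (φ : Metric.sphere (0 : E) r → Metric.sphere (0 : F) s)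
    (X : ∀ q : Metric.sphere (0 : E) r, Tan q) : Prop :=
  IsSmooth (fun q => (X q : E)) ∧ (∀ p, X p ∈ horizontalSpace φ p) ∧
    ∃ Y : ∀ y : Metric.sphere (0 : F) s, Tan y,
      IsSmooth (fun y => (Y y : F)) ∧ ∀ p, differential φ p (X p) = Y (φ p)

end Sphere

/-- The sphere `S³(√2)` in `ℝ⁴`. -/
abbrev S3 : Type := Metric.sphere (0 : EuclideanSpace ℝ (Fin 4)) (√2)

/-- The sphere `S²(1/√2)` in `ℝ³`. -/
abbrev S2 : Type := Metric.sphere (0 : EuclideanSpace ℝ (Fin 3)) (1 / √2)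

theorem S3_sum_sq (x : S3) : x.1 0 ^ 2 + x.1 1 ^ 2 + x.1 2 ^ 2 + x.1 3 ^ 2 = 2 := by
  have h : ‖x.1‖ = √2 := by simp
  have h2 := EuclideanSpace.norm_sq_eq x.1
  rw [h, Real.sq_sqrt (by norm_num)] at h2
  simpa [Fin.sum_univ_four] using h2.symm

/-- The Hopf map `ψ(z, w) = (2 z w̄, |z|² - |w|²) / (2√2)` with `z = x₁ + i x₂`, `w = x₃ + i x₄`
(the coordinates are numbered from `0` in the code). -/
def hopf (x : S3) : S2 :=
  ⟨(1 / (2 * √2)) • !₂[2 * x.1 0 * x.1 2 + 2 * x.1 1 * x.1 3,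
      2 * x.1 1 * x.1 2 - 2 * x.1 0 * x.1 3,
      x.1 0 ^ 2 + x.1 1 ^ 2 - x.1 2 ^ 2 - x.1 3 ^ 2], by
    have h := S3_sum_sq x
    have hs : (√2 : ℝ) ^ 2 = 2 := Real.sq_sqrt (by norm_num)
    rw [mem_sphere_zero_iff_norm, ← sq_eq_sq₀ (norm_nonneg _) (by positivity),
      EuclideanSpace.norm_sq_eq]
    simp only [Fin.sum_univ_three, PiLp.smul_apply, smul_eq_mul, Real.norm_eq_abs, sq_abs,
      mul_pow, div_pow, hs]
    simp only [Matrix.cons_val]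
    have : (x.1 0 ^ 2 + x.1 1 ^ 2 + x.1 2 ^ 2 + x.1 3 ^ 2) ^ 2 = 4 := by rw [h]; norm_num
    linear_combination (1 / 8) * this⟩

/-- The vector field `X₂(x) = (-x₃, x₄, x₁, -x₂) / √2`. -/
def X₂ (x : S3) : Tan x :=
  ⟨(1 / √2) • !₂[-x.1 2, x.1 3, x.1 0, -x.1 1], by
    rw [Submodule.mem_orthogonal_singleton_iff_inner_right, inner_smul_right]
    simp [PiLp.inner_apply, Fin.sum_univ_four]
    ring⟩

/-- The vector field `X₃(x) = (-x₄, -x₃, x₂, x₁) / √2`. -/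
def X₃ (x : S3) : Tan x :=
  ⟨(1 / √2) • !₂[-x.1 3, -x.1 2, x.1 1, x.1 0], by
    rw [Submodule.mem_orthogonal_singleton_iff_inner_right, inner_smul_right]
    simp [PiLp.inner_apply, Fin.sum_univ_four]
    ring⟩

/-- `λ_k = k(k+2)/2`, the `k`-th eigenvalue of the Laplacian of `S³(√2)`. -/
def eigenvalue (k : ℕ) : ℝ := (k : ℝ) * (k + 2) / 2

end HopfJacobi

end

/-! Write `T₁` for the vertical field of length `√2` and `V₂`, `V₃` for `dψ(X₂)`, `dψ(X₃)`, an
orthonormal frame of the pull-back bundle. In this frame (`jacobiOperator_hopf`) the zeroth-order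
part of the rough Laplacian cancels the curvature term, and what remains is `J(dψ X) = (Δf₂ - 2
T₁f₃) V₂ + (Δf₃ + 2 T₁f₂) V₃`. For eigenfunctions, with `μ = λ_k / 2 = k(k+2)/4`, the Jacobi
equation thus says `T₁f₂ = -μ f₃` and `T₁f₃ = μ f₂` (`mem_jacobiKernel_iff`): the pair `(f₂, f₃)`
rotates along the Hopf fibres with frequency `μ`.

Three facts restrict `k`. The fibres close up after time `2π`, so `μ` is an integer
(`exists_int_of_rotation`), which excludes `k = 1, 3`. If `k ≥ 4`, then `T₁²f = -μ² f` together with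
`T₁² + T₂² + T₃² = -2Δ` gives `(T₂² + T₃²) f = (μ² - 4μ) f`, whose coefficient is positive; the
maximum principle forces `f = 0` (`eq_zero_of_horizontal`). For `k = 2` the frequency is `2`,
exactly the rate that makes `dψ(X)` constant along the fibres, so it descends to the two-sphere and
`X` is basic (`isBasic_of_rotation`).

Conversely, a basic field rotates at rate `2` (`rotation_of_isBasic`), and for `k = 0` the functions
are harmonic, hence constant (`harmonic_const`), so both sides of the rotation equations vanish. -/

open scoped ContDiff

noncomputable section

namespace HopfJacobi

/-! ### Calculus on round spheres through radial extensions -/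

section GeneralSphere

variable {E F G : Type*} [NormedAddCommGroup E] [InnerProductSpace ℝ E]
  [NormedAddCommGroup F] [InnerProductSpace ℝ F] [NormedAddCommGroup G] [NormedSpace ℝ G] {r s : ℝ}

theorem dirDeriv_apply (f : Metric.sphere (0 : E) r → G) (p : Metric.sphere (0 : E) r) (v : Tan p) :
    dirDeriv f p v = fderiv ℝ (radialExt f) (p : E) (v : E) := rfl

theorem mem_Tan {p : Metric.sphere (0 : E) r} {v : E} : v ∈ Tan p ↔ inner ℝ (p : E) v = 0 :=
  Submodule.mem_orthogonal_singleton_iff_inner_right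

theorem inner_coe_Tan (p : Metric.sphere (0 : E) r) (v : Tan p) : inner ℝ (p : E) (v : E) = 0 :=
  mem_Tan.1 v.2

theorem norm_coe_sphere {E : Type*} [NormedAddCommGroup E] {r : ℝ}
    (p : Metric.sphere (0 : E) r) : ‖(p : E)‖ = r := by simp

theorem sphere_ne_zero {E : Type*} [NormedAddCommGroup E] {r : ℝ} (hr : 0 < r)
    (p : Metric.sphere (0 : E) r) : (p : E) ≠ 0 := by
  rw [← norm_ne_zero_iff, norm_coe_sphere]; exact hr.ne'

/-- The point of the sphere on the ray through `x`. -/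
def retract (hr : 0 < r) (x : E) (hx : x ≠ 0) : Metric.sphere (0 : E) r :=
  ⟨(r / ‖x‖) • x, by
    simp [norm_smul, abs_of_pos hr, div_mul_cancel₀ _ (norm_ne_zero_iff.2 hx)]⟩

theorem radialExt_eq (hr : 0 < r) {H : Type*} [Zero H] (f : Metric.sphere (0 : E) r → H) (x : E)
    (hx : x ≠ 0) : radialExt f x = f (retract hr x hx) :=
  Subtype.val_injective.extend_apply f 0 (retract hr x hx)

theorem radialExt_smul {H : Type*} [Zero H] (f : Metric.sphere (0 : E) r → H) (x : E) {c : ℝ}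
    (hc : 0 < c) : radialExt f (c • x) = radialExt f x := by
  unfold radialExt
  congr 1
  by_cases hx : x = 0
  · simp [hx]
  · have := norm_ne_zero_iff.2 hx
    rw [norm_smul, Real.norm_eq_abs, abs_of_pos hc, smul_smul]
    congr 1
    field_simp

theorem eventually_ne_zero {E : Type*} [NormedAddCommGroup E] {r : ℝ} (hr : 0 < r) (p : Metric.sphere (0 : E) r) :
    ∀ᶠ x in nhds (p : E), x ≠ 0 :=
  continuous_id.continuousAt.eventually_ne (sphere_ne_zero hr p)

/-- Differentiate the constant `(r / ‖x‖)² ‖x‖² = r²` along `v`; the contribution of `‖x‖²` drops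
out because `v ⟂ p`. -/
theorem hasFDerivAt_scale (hr : 0 < r) (p : Metric.sphere (0 : E) r) :
    ∃ L : E →L[ℝ] ℝ, HasFDerivAt (fun x : E => r / ‖x‖) L (p : E) ∧ ∀ v ∈ Tan p, L v = 0 := by
  have hp := sphere_ne_zero hr p
  have hn : DifferentiableAt ℝ (fun x : E => ‖x‖) (p : E) :=
    differentiableAt_id.norm ℝ hp
  have h1 : DifferentiableAt ℝ (fun x : E => r / ‖x‖) (p : E) := by
    simp_rw [div_eq_mul_inv]
    exact (hn.fun_inv (norm_ne_zero_iff.2 hp)).const_mul r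
  refine ⟨_, h1.hasFDerivAt, fun v hv => ?_⟩
  have h2 := (h1.hasFDerivAt.mul' h1.hasFDerivAt).mul' (hasFDerivAt_id (p : E)).norm_sq
  have h3 : HasFDerivAt (fun _ : E => r ^ 2) (0 : E →L[ℝ] ℝ) (p : E) := hasFDerivAt_const _ _
  have h4 := h3.congr_of_eventuallyEq (f₁ := fun x : E => r / ‖x‖ * (r / ‖x‖) * ‖x‖ ^ 2) (by
    filter_upwards [eventually_ne_zero hr p] with x hx
    have := norm_ne_zero_iff.2 hx
    field_simp)
  have h5 := congrArg (fun L : E →L[ℝ] ℝ => L v) (HasFDerivAt.unique h2 h4)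
  have h6 := mem_Tan.1 hv
  have : fderiv ℝ (fun x : E => r / ‖x‖) (p : E) v * (2 * r ^ 2) = 0 := by
    simp [hr.ne', h6] at h5
    linear_combination 2 * r ^ 2 * h5
  have h7 : (2 * r ^ 2) ≠ 0 := by positivity
  exact (mul_eq_zero.1 this).resolve_right h7

theorem hasFDerivAt_retraction (hr : 0 < r) (p : Metric.sphere (0 : E) r) :
    ∃ L : E →L[ℝ] E, HasFDerivAt (fun x : E => (r / ‖x‖) • x) L (p : E) ∧ ∀ v ∈ Tan p, L v = v := by
  obtain ⟨L, hL, h0⟩ := hasFDerivAt_scale hr p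
  refine ⟨_, hL.smul (hasFDerivAt_id (p : E)), fun v hv => ?_⟩
  simp [h0 v hv, hr.ne']

/-- The derivative on the sphere of the restriction of an ambient map. -/
theorem dirDeriv_restrict (hr : 0 < r) {g : E → G} {f : Metric.sphere (0 : E) r → G}
    (hf : ∀ q : Metric.sphere (0 : E) r, f q = g q) (p : Metric.sphere (0 : E) r)
    {g' : E →L[ℝ] G} (hg : HasFDerivAt g g' (p : E)) (v : Tan p) :
    dirDeriv f p v = g' v := by
  obtain ⟨L, hL, h0⟩ := hasFDerivAt_retraction hr p
  have hpp : (r / ‖(p : E)‖) • (p : E) = p := by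
    rw [norm_coe_sphere, div_self hr.ne', one_smul]
  have h1 : HasFDerivAt (fun x : E => g ((r / ‖x‖) • x)) (g'.comp L) (p : E) :=
    HasFDerivAt.comp (p : E) (f := fun x : E => (r / ‖x‖) • x) (by rwa [hpp]) hL
  have h2 : HasFDerivAt (radialExt f) (g'.comp L) (p : E) :=
    h1.congr_of_eventuallyEq (by
      filter_upwards [eventually_ne_zero hr p] with x hx
      rw [radialExt_eq hr f x hx, hf]; rfl)
  rw [dirDeriv_apply, h2.fderiv]
  simp [h0 v v.2]

theorem isSmooth_restrict (hr : 0 < r) {g : E → G} {f : Metric.sphere (0 : E) r → G}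
    (hf : ∀ q : Metric.sphere (0 : E) r, f q = g q) (hg : ContDiffOn ℝ ∞ g {0}ᶜ) :
    IsSmooth f := by
  have h1 : ContDiffOn ℝ ∞ (fun x : E => (r / ‖x‖) • x) {0}ᶜ := by
    have h0 : ∀ x ∈ ({0}ᶜ : Set E), x ≠ 0 := fun x hx => hx
    exact (contDiffOn_const.div (contDiffOn_id.norm ℝ h0)
      fun x hx => norm_ne_zero_iff.2 (h0 x hx)).smul contDiffOn_id
  refine (hg.comp h1 fun x hx => ?_).congr fun x hx => ?_
  · exact sphere_ne_zero hr (retract hr x hx)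
  · rw [radialExt_eq hr f x hx, hf]; rfl

theorem IsSmooth.contDiffAt {f : Metric.sphere (0 : E) r → G} (hf : IsSmooth f) {x : E}
    (hx : x ≠ 0) : ContDiffAt ℝ ∞ (radialExt f) x :=
  ContDiffOn.contDiffAt hf (isOpen_compl_singleton.mem_nhds hx)

theorem IsSmooth.hasFDerivAt (hr : 0 < r) {f : Metric.sphere (0 : E) r → G} (hf : IsSmooth f)
    (p : Metric.sphere (0 : E) r) :
    HasFDerivAt (radialExt f) (fderiv ℝ (radialExt f) p) (p : E) :=
  ((hf.contDiffAt (sphere_ne_zero hr p)).differentiableAt (by simp)).hasFDerivAt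

theorem IsSmooth.hasFDerivAt_fderiv (hr : 0 < r) {f : Metric.sphere (0 : E) r → G}
    (hf : IsSmooth f) (p : Metric.sphere (0 : E) r) :
    HasFDerivAt (fderiv ℝ (radialExt f)) (fderiv ℝ (fderiv ℝ (radialExt f)) p) (p : E) :=
  (((hf.contDiffAt (sphere_ne_zero hr p)).fderiv_right (m := ∞) (by simp)).differentiableAt
    (by simp)).hasFDerivAt

/-- The extension is homogeneous of degree zero. This is what lets ambient derivatives replace
intrinsic ones: normal components of the direction never contribute. -/
theorem fderiv_radialExt_self (hr : 0 < r) {f : Metric.sphere (0 : E) r → G} (hf : IsSmooth f)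
    (p : Metric.sphere (0 : E) r) : fderiv ℝ (radialExt f) p (p : E) = 0 := by
  have h1 : HasDerivAt (fun c : ℝ => c • (p : E)) (p : E) 1 := by
    simpa using (hasDerivAt_id (1 : ℝ)).smul_const (p : E)
  have h2 : HasDerivAt (fun c : ℝ => radialExt f (c • (p : E)))
      (fderiv ℝ (radialExt f) p (p : E)) 1 :=
    HasFDerivAt.comp_hasDerivAt (l := radialExt f) (f := fun c : ℝ => c • (p : E)) (1 : ℝ)
      (by simpa using hf.hasFDerivAt hr p) h1
  have h3 : HasDerivAt (fun c : ℝ => radialExt f (c • (p : E))) 0 1 :=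
    (hasDerivAt_const (1 : ℝ) (radialExt f (p : E))).congr_of_eventuallyEq (by
      filter_upwards [lt_mem_nhds (zero_lt_one' ℝ)] with c hc
      exact radialExt_smul f p hc)
  exact h2.unique h3

theorem coe_projection_Tan (p : Metric.sphere (0 : E) r) (v : E) :
    ((Tan p).orthogonalProjectionOnto v : E) = v - (inner ℝ (p : E) v / r ^ 2) • (p : E) := by
  rw [Submodule.coe_orthogonalProjectionOnto_apply, Submodule.starProjection_orthogonal_val,
    Submodule.starProjection_singleton]
  simp

theorem projection_Tan_self (p : Metric.sphere (0 : E) r) (c : ℝ) :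
    (Tan p).orthogonalProjectionOnto (c • (p : E)) = 0 := by
  rw [map_smul, Submodule.orthogonalProjectionOnto_orthogonalComplement_singleton_eq_zero,
    smul_zero]

theorem projection_Tan_coe (p : Metric.sphere (0 : E) r) (v : Tan p) :
    (Tan p).orthogonalProjectionOnto (v : E) = v :=
  Submodule.orthogonalProjectionOnto_mem_subspace_eq_self v

theorem dirDeriv_extendVec (hr : 0 < r) {f : Metric.sphere (0 : E) r → G} (hf : IsSmooth f)
    (p : Metric.sphere (0 : E) r) (v : E) :
    dirDeriv f p (extendVec v p) = fderiv ℝ (radialExt f) p v := by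
  rw [dirDeriv_apply, extendVec, coe_projection_Tan, map_sub, map_smul,
    fderiv_radialExt_self hr hf, smul_zero, sub_zero]

/-- The extension of `v` is `v - (⟨q, v⟩ / r²) q`; only differentiating the last factor `q` leaves a
tangential term. In particular the derivative vanishes at any point where `v` is tangent, so the
correction terms in second covariant derivatives disappear. -/
theorem leviCivita_extendVec (hr : 0 < r) (v : E) (p : Metric.sphere (0 : E) r) (u : Tan p) :
    leviCivita (extendVec v) p u = -(inner ℝ (p : E) v / r ^ 2) • u := by
  have hd := (hasFDerivAt_const v (p : E)).sub
    ((((hasFDerivAt_id (p : E)).inner ℝ (hasFDerivAt_const v (p : E))).mul_const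
      (r ^ 2)⁻¹).smul (hasFDerivAt_id (p : E)))
  have := dirDeriv_restrict hr (f := fun q => (extendVec v q : E)) (fun q => by
    rw [extendVec, coe_projection_Tan, div_eq_mul_inv]; rfl) p hd u
  rw [leviCivita, pullbackConn, this]
  simp [div_eq_mul_inv]

theorem hessian_eq (hr : 0 < r) {f : Metric.sphere (0 : E) r → ℝ} (hf : IsSmooth f)
    (p : Metric.sphere (0 : E) r) (u v : Tan p) :
    hessian f p u v = fderiv ℝ (fderiv ℝ (radialExt f)) p u v := by
  have h := dirDeriv_restrict hr (f := fun q => dirDeriv f q (extendVec (v : E) q))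
    (fun q => dirDeriv_extendVec hr hf q v) p
    ((hf.hasFDerivAt_fderiv hr p).clm_apply (hasFDerivAt_const (v : E) (p : E))) u
  rw [hessian, h, leviCivita_extendVec hr, inner_coe_Tan]
  simp

theorem curvature_eq (hr : 0 < r) (p : Metric.sphere (0 : E) r) (u v w : Tan p) :
    curvature p u v w
      = (1 / r ^ 2) • ((inner ℝ (v : E) (w : E)) • u - (inner ℝ (u : E) (w : E)) • v) := by
  have key : ∀ a b : Tan p,
      leviCivita (fun q => leviCivita (extendVec (w : E)) q (extendVec (a : E) q)) p b
        = (-(inner ℝ (b : E) (w : E) / r ^ 2)) • a := by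
    intro a b
    have hd := ((((hasFDerivAt_id (p : E)).inner ℝ (hasFDerivAt_const (w : E) (p : E))).mul_const
      (r ^ 2)⁻¹).neg).smul ((hasFDerivAt_const (a : E) (p : E)).sub
      ((((hasFDerivAt_id (p : E)).inner ℝ (hasFDerivAt_const (a : E) (p : E))).mul_const
      (r ^ 2)⁻¹).smul (hasFDerivAt_id (p : E))))
    have := dirDeriv_restrict hr
      (f := fun q => (leviCivita (extendVec (w : E)) q (extendVec (a : E) q) : E)) (fun q => by
        rw [leviCivita_extendVec hr, extendVec, Submodule.coe_smul, coe_projection_Tan,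
          div_eq_mul_inv, div_eq_mul_inv]; rfl) p hd b
    rw [leviCivita, pullbackConn, this]
    simp [inner_coe_Tan, div_eq_mul_inv, mul_comm]
  rw [curvature, curvatureField, leviCivita_extendVec hr]
  have e1 : extendVec (u : E) p = u := projection_Tan_coe p u
  have e2 : extendVec (v : E) p = v := projection_Tan_coe p v
  rw [key, key, e1, e2, inner_coe_Tan]
  simp only [zero_div, neg_zero, zero_smul, sub_zero, neg_smul, smul_sub, smul_smul]
  rw [one_div, div_eq_inv_mul, div_eq_inv_mul]
  abel

theorem differential_coe (φ : Metric.sphere (0 : E) r → Metric.sphere (0 : F) s)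
    (p : Metric.sphere (0 : E) r) (v : Tan p) :
    (differential φ p v : F) = fderiv ℝ (radialExt fun q => (φ q : F)) p (v : E) := rfl

theorem inner_fderiv_section (hr : 0 < r)
    {φ : Metric.sphere (0 : E) r → Metric.sphere (0 : F) s} (hφ : IsSmooth fun q => (φ q : F))
    {V : ∀ q, Tan (φ q)} (hV : IsSmooth fun q => (V q : F)) (p : Metric.sphere (0 : E) r) (v : E) :
    inner ℝ (φ p : F) (fderiv ℝ (radialExt fun q => (V q : F)) p v)
      = - inner ℝ (fderiv ℝ (radialExt fun q => (φ q : F)) p v) (V p : F) := by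
  have h1 := (hφ.hasFDerivAt hr p).inner ℝ (hV.hasFDerivAt hr p)
  have h2 : HasFDerivAt (fun x => inner ℝ (radialExt (fun q => (φ q : F)) x)
      (radialExt (fun q => (V q : F)) x)) (0 : E →L[ℝ] ℝ) (p : E) :=
    (hasFDerivAt_const (0 : ℝ) (p : E)).congr_of_eventuallyEq (by
      filter_upwards [eventually_ne_zero hr p] with x hx
      rw [radialExt_eq hr _ x hx, radialExt_eq hr _ x hx, inner_coe_Tan])
  have h3 := congrArg (fun L : E →L[ℝ] ℝ => L v) (h1.unique h2)
  simp [radialExt_coe] at h3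
  linarith

/-- The first covariant derivative is the ambient one minus its component along `φ`. Differentiating
that component and projecting leaves a multiple of `dφ u`, with coefficient rewritten through `⟨φ,
V⟩ = 0`. -/
theorem secondCovDeriv_eq (hr : 0 < r)
    {φ : Metric.sphere (0 : E) r → Metric.sphere (0 : F) s} (hφ : IsSmooth fun q => (φ q : F))
    {V : ∀ q, Tan (φ q)} (hV : IsSmooth fun q => (V q : F)) (p : Metric.sphere (0 : E) r)
    (u v : Tan p) :
    secondCovDeriv φ V p u v
      = (Tan (φ p)).orthogonalProjectionOnto
          (fderiv ℝ (fderiv ℝ (radialExt fun q => (V q : F))) p u v)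
        + (inner ℝ (differential φ p v : F) (V p : F) / s ^ 2) • differential φ p u := by
  have hA := (hV.hasFDerivAt_fderiv hr p).clm_apply (hasFDerivAt_const (v : E) (p : E))
  have hd := hA.sub ((((hφ.hasFDerivAt hr p).inner ℝ hA).mul_const (s ^ 2)⁻¹).smul
    (hφ.hasFDerivAt hr p))
  have h := dirDeriv_restrict hr
    (f := fun q => (pullbackConn φ V q (extendVec (v : E) q) : F)) (fun q => by
      rw [pullbackConn, dirDeriv_extendVec hr hV, coe_projection_Tan, div_eq_mul_inv]
      exact congrArg (fun y : F => fderiv ℝ (radialExt fun q => (V q : F)) q v -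
        (inner ℝ y (fderiv ℝ (radialExt fun q => (V q : F)) q v) * (s ^ 2)⁻¹) • y)
        (radialExt_coe (fun q => (φ q : F)) q).symm) p hd u
  have e : pullbackConn φ V p (leviCivita (extendVec (v : E)) p u) = 0 := by
    rw [leviCivita_extendVec hr, inner_coe_Tan]
    simp [pullbackConn]
  rw [secondCovDeriv, e, sub_zero, pullbackConn, h]
  simp only [sub_apply, add_apply, smul_apply, ContinuousLinearMap.smulRight_apply, map_sub,
    map_add, radialExt_coe, map_smul, inner_fderiv_section hr hφ hV]
  have e3 : (Tan (φ p)).orthogonalProjectionOnto (φ p : F) = 0 := by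
    simp
  have e2 : (Tan (φ p)).orthogonalProjectionOnto (fderiv ℝ (radialExt fun q => (φ q : F)) p u)
      = differential φ p u := projection_Tan_coe (φ p) (differential φ p u)
  rw [e2, e3]
  simp [differential_coe, div_eq_mul_inv]

/-! ### Traces in an arbitrary orthonormal frame -/

/-- The tensor `∑ eᵢ ⊗ eᵢ` does not depend on the orthonormal basis. This replaces the arbitrary
basis in the definitions by one adapted to the Hopf map. -/
theorem sum_bilin_orthonormalBasis {T : Type*} [NormedAddCommGroup T] [InnerProductSpace ℝ T]
    [FiniteDimensional ℝ T] {ι : Type*} [Fintype ι] {W : Type*} [AddCommGroup W] [Module ℝ W]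
    (B : T →ₗ[ℝ] T →ₗ[ℝ] W) (b : OrthonormalBasis ι ℝ T) :
    ∑ i, B (stdOrthonormalBasis ℝ T i) (stdOrthonormalBasis ℝ T i) = ∑ i, B (b i) (b i) := by
  have h := (InnerProductSpace.canonicalCovariantTensor_eq_sum T (stdOrthonormalBasis ℝ T)).symm.trans
    (InnerProductSpace.canonicalCovariantTensor_eq_sum T b)
  simpa using congrArg (TensorProduct.lift B) h

/-- The Euclidean Hessian of the radial extension, restricted to the tangent space. -/
def tanHess (f : Metric.sphere (0 : E) r → G) (p : Metric.sphere (0 : E) r) :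
    Tan p →ₗ[ℝ] Tan p →ₗ[ℝ] G :=
  LinearMap.mk₂ ℝ (fun u v => fderiv ℝ (fderiv ℝ (radialExt f)) p (u : E) (v : E))
    (by intros; simp) (by intros; simp) (by intros; simp) (by intros; simp)

theorem laplacian_eq_sum [FiniteDimensional ℝ E] (hr : 0 < r) {f : Metric.sphere (0 : E) r → ℝ}
    (hf : IsSmooth f) (p : Metric.sphere (0 : E) r) {ι : Type*} [Fintype ι]
    (b : OrthonormalBasis ι ℝ (Tan p)) :
    laplacian f p = -∑ i, tanHess f p (b i) (b i) := by
  rw [← sum_bilin_orthonormalBasis, laplacian]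
  simp_rw [hessian_eq hr hf]
  rfl

/-- The term `⟨dφ e, V⟩ dφ e / s²` of the second covariant derivative cancels the same term of the
curvature of the target, so only the projected ambient Hessian and `|dφ|² V / s²` survive. -/
theorem jacobiOperator_eq_sum [FiniteDimensional ℝ E] (hr : 0 < r) (hs : 0 < s)
    {φ : Metric.sphere (0 : E) r → Metric.sphere (0 : F) s} (hφ : IsSmooth fun q => (φ q : F))
    {V : ∀ q, Tan (φ q)} (hV : IsSmooth fun q => (V q : F)) (p : Metric.sphere (0 : E) r)
    {ι : Type*} [Fintype ι] (b : OrthonormalBasis ι ℝ (Tan p)) :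
    jacobiOperator φ V p =
      -(Tan (φ p)).orthogonalProjectionOnto (∑ i, tanHess (fun q => (V q : F)) p (b i) (b i))
      - (1 / s ^ 2) • ∑ i, inner ℝ (differential φ p (b i)) (differential φ p (b i)) • V p := by
  set D := differential φ p
  let B : Tan p →ₗ[ℝ] Tan p →ₗ[ℝ] Tan (φ p) := LinearMap.mk₂ ℝ
    (fun u v => -((Tan (φ p)).orthogonalProjectionOnto (tanHess (fun q => (V q : F)) p u v)
        + (inner ℝ (D v) (V p) / s ^ 2) • D u)
      + (1 / s ^ 2) • (inner ℝ (D v) (V p) • D u - inner ℝ (D u) (D v) • V p))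
    (by
      intros
      simp only [map_add, LinearMap.add_apply, inner_add_left]
      module)
    (by
      intros
      simp only [map_smul, LinearMap.smul_apply, inner_smul_left, smul_add, smul_neg, smul_sub,
        smul_smul, RCLike.conj_to_real]
      module)
    (by
      intros
      simp only [map_add, inner_add_left, inner_add_right]
      module)
    (by
      intros
      simp only [map_smul, inner_smul_left, inner_smul_right, RCLike.conj_to_real]
      module)
  have h := sum_bilin_orthonormalBasis B b
  have h1 : jacobiOperator φ V p
      = ∑ i, B (stdOrthonormalBasis ℝ (Tan p) i) (stdOrthonormalBasis ℝ (Tan p) i) := by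
    rw [jacobiOperator, roughLaplacian, ← Finset.sum_neg_distrib, ← Finset.sum_add_distrib]
    refine Finset.sum_congr rfl fun i _ => ?_
    rw [secondCovDeriv_eq hr hφ hV, curvature_eq hs, real_inner_comm (D _ : F) (V p : F)]
    rfl
  rw [h1, h, map_sum, Finset.smul_sum, ← Finset.sum_neg_distrib, ← Finset.sum_sub_distrib]
  refine Finset.sum_congr rfl fun i _ => ?_
  simp only [B, LinearMap.mk₂_apply]
  module

/-! ### Derivatives along great circles -/

/-- The great circle through `p` with direction `w`. -/
def greatCircle (p w : E) (θ : ℝ) : E := Real.cos θ • p + Real.sin θ • w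

theorem hasDerivAt_greatCircle (p w : E) (θ : ℝ) :
    HasDerivAt (greatCircle p w) (-Real.sin θ • p + Real.cos θ • w) θ :=
  ((Real.hasDerivAt_cos θ).smul_const p).add ((Real.hasDerivAt_sin θ).smul_const w)

theorem norm_greatCircle (p : Metric.sphere (0 : E) r) (w : Tan p) (hw : ‖w‖ = r) (θ : ℝ) :
    greatCircle (p : E) w θ ∈ Metric.sphere (0 : E) r := by
  have h0 : 0 ≤ r := hw ▸ norm_nonneg _
  rw [Submodule.coe_norm] at hw
  rw [mem_sphere_zero_iff_norm, ← sq_eq_sq₀ (norm_nonneg _) h0, greatCircle, norm_add_sq_real,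
    inner_smul_left, inner_smul_right, inner_coe_Tan, norm_smul, norm_smul, mul_pow, mul_pow,
    norm_coe_sphere, hw, Real.norm_eq_abs, Real.norm_eq_abs, sq_abs, sq_abs]
  linear_combination r ^ 2 * Real.sin_sq_add_cos_sq θ

theorem hasDerivAt_comp_greatCircle (hr : 0 < r) {f : Metric.sphere (0 : E) r → G}
    (hf : IsSmooth f) (p : Metric.sphere (0 : E) r) (w : Tan p) (hw : ‖w‖ = r) (θ : ℝ) :
    HasDerivAt (fun t => radialExt f (greatCircle (p : E) w t))
      (fderiv ℝ (radialExt f) (greatCircle (p : E) w θ)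
        (-Real.sin θ • (p : E) + Real.cos θ • (w : E))) θ :=
  HasFDerivAt.comp_hasDerivAt (l := radialExt f) (f := greatCircle (p : E) w) θ (hf.hasFDerivAt hr ⟨_, norm_greatCircle p w hw θ⟩)
    (hasDerivAt_greatCircle _ _ θ)

theorem hasDerivAt_comp_greatCircle_zero (hr : 0 < r) {f : Metric.sphere (0 : E) r → G}
    (hf : IsSmooth f) (p : Metric.sphere (0 : E) r) (w : Tan p) (hw : ‖w‖ = r) :
    HasDerivAt (fun t => radialExt f (greatCircle (p : E) w t)) (dirDeriv f p w) 0 := by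
  simpa [greatCircle, dirDeriv_apply] using hasDerivAt_comp_greatCircle hr hf p w hw 0

/-- The acceleration of the great circle at `p` is `-p`, which is radial and hence invisible to the
radial extension. -/
theorem hasDerivAt_deriv_comp_greatCircle (hr : 0 < r) {f : Metric.sphere (0 : E) r → G}
    (hf : IsSmooth f) (p : Metric.sphere (0 : E) r) (w : Tan p) (hw : ‖w‖ = r) :
    HasDerivAt (deriv fun t => radialExt f (greatCircle (p : E) w t)) (tanHess f p w w) 0 := by
  have h0 : greatCircle (p : E) w 0 = p := by simp [greatCircle]
  have hd : (deriv fun t => radialExt f (greatCircle (p : E) w t))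
      = fun θ => fderiv ℝ (radialExt f) (greatCircle (p : E) w θ)
        (-Real.sin θ • (p : E) + Real.cos θ • (w : E)) :=
    funext fun θ => (hasDerivAt_comp_greatCircle hr hf p w hw θ).deriv
  rw [hd]
  have h1 : HasDerivAt (fun θ => fderiv ℝ (radialExt f) (greatCircle (p : E) w θ))
      (fderiv ℝ (fderiv ℝ (radialExt f)) p (-Real.sin 0 • (p : E) + Real.cos 0 • (w : E))) 0 :=
    HasFDerivAt.comp_hasDerivAt (0 : ℝ) (by rw [h0]; exact hf.hasFDerivAt_fderiv hr p)
      (hasDerivAt_greatCircle (p : E) w 0)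
  have h2 : HasDerivAt (fun θ : ℝ => -Real.sin θ • (p : E) + Real.cos θ • (w : E)) (-(p : E)) 0 := by
    have h := ((Real.hasDerivAt_sin 0).neg.smul_const (p : E)).add
      ((Real.hasDerivAt_cos 0).smul_const (w : E))
    simp only [Real.cos_zero, Real.sin_zero, neg_zero, zero_smul, add_zero, neg_one_smul] at h
    exact h
  have h3 := h1.clm_apply h2
  simpa [h0, fderiv_radialExt_self hr hf, tanHess] using h3

/-- If `c > 0`, the point is also a local minimum, so `φ` is locally constant and `c = 0`. -/
theorem second_deriv_nonpos_of_isMax {φ : ℝ → ℝ} {x c : ℝ} (hc : ContinuousAt φ x)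
    (h2 : HasDerivAt (deriv φ) c x) (hmax : IsLocalMax φ x) : c ≤ 0 := by
  by_contra! hpos
  have hmin := isLocalMin_of_deriv_deriv_pos (by rwa [h2.deriv]) hmax.deriv_eq_zero hc
  have hev : ∀ᶠ y in nhds x, φ y = φ x := by
    filter_upwards [hmax, hmin] with y h h' using le_antisymm h h'
  have hd : deriv φ =ᶠ[nhds x] fun _ => 0 := by
    filter_upwards [hev.eventually_nhds] with y hy
    exact ((hasDerivAt_const y (φ x)).congr_of_eventuallyEq hy).deriv
  have := h2.unique ((hasDerivAt_const x (0 : ℝ)).congr_of_eventuallyEq hd)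
  linarith

/-- At a maximum the Hessian is negative semidefinite. -/
theorem tanHess_nonpos_of_isMax (hr : 0 < r) {f : Metric.sphere (0 : E) r → ℝ} (hf : IsSmooth f)
    (p : Metric.sphere (0 : E) r) (hmax : ∀ q, f q ≤ f p) (w : Tan p) (hw : ‖w‖ = r) :
    tanHess f p w w ≤ 0 := by
  refine second_deriv_nonpos_of_isMax (hasDerivAt_comp_greatCircle_zero hr hf p w hw).continuousAt
    (hasDerivAt_deriv_comp_greatCircle hr hf p w hw) (Filter.Eventually.of_forall fun θ => ?_)
  have h0 : greatCircle (p : E) w 0 = p := by simp [greatCircle]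
  change radialExt f (greatCircle (p : E) w θ) ≤ radialExt f (greatCircle (p : E) w 0)
  rw [h0, radialExt_coe, radialExt_coe f ⟨_, norm_greatCircle p w hw θ⟩]
  exact hmax _

/-! ### Continuity, sum and product rules -/

theorem IsSmooth.continuous (hr : 0 < r) {f : Metric.sphere (0 : E) r → G} (hf : IsSmooth f) :
    Continuous f := by
  have h : f = fun p : Metric.sphere (0 : E) r => radialExt f (p : E) := funext fun p => (radialExt_coe f p).symm
  rw [h, continuous_iff_continuousAt]
  intro p
  exact ContinuousAt.comp (g := radialExt f) (hf.hasFDerivAt hr p).continuousAt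
    continuous_subtype_val.continuousAt

theorem radialExt_add {H : Type*} [AddCommGroup H] (f g : Metric.sphere (0 : E) r → H) :
    radialExt (fun q => f q + g q) = fun x => radialExt f x + radialExt g x := by
  funext x
  by_cases h : ∃ q : Metric.sphere (0 : E) r, (q : E) = (r / ‖x‖) • x
  · obtain ⟨q, hq⟩ := h
    simp only [radialExt, ← hq, Subtype.val_injective.extend_apply]
  · simp only [radialExt, Function.extend_apply' _ _ _ h, Pi.zero_apply, add_zero]

theorem radialExt_smul_fun (f : Metric.sphere (0 : E) r → ℝ) (g : Metric.sphere (0 : E) r → G) :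
    radialExt (fun q => f q • g q) = fun x => radialExt f x • radialExt g x := by
  funext x
  by_cases h : ∃ q : Metric.sphere (0 : E) r, (q : E) = (r / ‖x‖) • x
  · obtain ⟨q, hq⟩ := h
    simp only [radialExt, ← hq, Subtype.val_injective.extend_apply]
  · simp only [radialExt, Function.extend_apply' _ _ _ h, Pi.zero_apply, smul_zero]

theorem IsSmooth.add {f g : Metric.sphere (0 : E) r → G} (hf : IsSmooth f) (hg : IsSmooth g) :
    IsSmooth fun q => f q + g q := by
  unfold IsSmooth at *
  rw [radialExt_add]
  exact ContDiffOn.add hf hg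

theorem IsSmooth.smul {f : Metric.sphere (0 : E) r → ℝ} {g : Metric.sphere (0 : E) r → G}
    (hf : IsSmooth f) (hg : IsSmooth g) : IsSmooth fun q => f q • g q := by
  unfold IsSmooth at *
  rw [radialExt_smul_fun]
  exact ContDiffOn.smul hf hg

theorem dirDeriv_add (hr : 0 < r) {f g : Metric.sphere (0 : E) r → G} (hf : IsSmooth f)
    (hg : IsSmooth g) (p : Metric.sphere (0 : E) r) (v : Tan p) :
    dirDeriv (fun q => f q + g q) p v = dirDeriv f p v + dirDeriv g p v := by
  rw [dirDeriv_apply, radialExt_add, ((hf.hasFDerivAt hr p).fun_add (hg.hasFDerivAt hr p)).fderiv]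
  rfl

theorem dirDeriv_smul (hr : 0 < r) {f : Metric.sphere (0 : E) r → ℝ}
    {g : Metric.sphere (0 : E) r → G} (hf : IsSmooth f) (hg : IsSmooth g)
    (p : Metric.sphere (0 : E) r) (v : Tan p) :
    dirDeriv (fun q => f q • g q) p v = f p • dirDeriv g p v + dirDeriv f p v • g p := by
  rw [dirDeriv_apply, radialExt_smul_fun,
    ((hf.hasFDerivAt hr p).fun_smul (hg.hasFDerivAt hr p)).fderiv]
  simp [radialExt_coe, dirDeriv_apply]

theorem tanHess_add (hr : 0 < r) {f g : Metric.sphere (0 : E) r → G} (hf : IsSmooth f)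
    (hg : IsSmooth g) (p : Metric.sphere (0 : E) r) (w : Tan p) (hw : ‖w‖ = r) :
    tanHess (fun q => f q + g q) p w w = tanHess f p w w + tanHess g p w w := by
  refine (hasDerivAt_deriv_comp_greatCircle hr (hf.add hg) p w hw).unique ?_
  have h : (deriv fun t => radialExt (fun q => f q + g q) (greatCircle (p : E) w t)) =
      fun t => deriv (fun t => radialExt f (greatCircle (p : E) w t)) t
        + deriv (fun t => radialExt g (greatCircle (p : E) w t)) t := by
    rw [radialExt_add]
    funext t
    exact deriv_fun_add (hasDerivAt_comp_greatCircle hr hf p w hw t).differentiableAt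
      (hasDerivAt_comp_greatCircle hr hg p w hw t).differentiableAt
  rw [h]
  exact (hasDerivAt_deriv_comp_greatCircle hr hf p w hw).fun_add
    (hasDerivAt_deriv_comp_greatCircle hr hg p w hw)

theorem tanHess_smul (hr : 0 < r) {f : Metric.sphere (0 : E) r → ℝ}
    {g : Metric.sphere (0 : E) r → G} (hf : IsSmooth f) (hg : IsSmooth g)
    (p : Metric.sphere (0 : E) r) (w : Tan p) (hw : ‖w‖ = r) :
    tanHess (fun q => f q • g q) p w w
      = tanHess f p w w • g p + (2 * dirDeriv f p w) • dirDeriv g p w + f p • tanHess g p w w := by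
  refine (hasDerivAt_deriv_comp_greatCircle hr (hf.smul hg) p w hw).unique ?_
  have h : (deriv fun t => radialExt (fun q => f q • g q) (greatCircle (p : E) w t)) =
      fun t => radialExt f (greatCircle (p : E) w t)
          • deriv (fun t => radialExt g (greatCircle (p : E) w t)) t
        + deriv (fun t => radialExt f (greatCircle (p : E) w t)) t
          • radialExt g (greatCircle (p : E) w t) := by
    rw [radialExt_smul_fun]
    funext t
    exact deriv_fun_smul (hasDerivAt_comp_greatCircle hr hf p w hw t).differentiableAt
      (hasDerivAt_comp_greatCircle hr hg p w hw t).differentiableAt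
  rw [h]
  have f1 := hasDerivAt_comp_greatCircle_zero hr hf p w hw
  have g1 := hasDerivAt_comp_greatCircle_zero hr hg p w hw
  have h0 : greatCircle (p : E) w 0 = p := by simp [greatCircle]
  have := (f1.fun_smul (hasDerivAt_deriv_comp_greatCircle hr hg p w hw)).fun_add
    ((hasDerivAt_deriv_comp_greatCircle hr hf p w hw).fun_smul g1)
  simp only [f1.deriv, g1.deriv, h0, radialExt_coe] at this
  convert this using 1
  module

/-- The derivatives along a great circle of the restriction of an ambient map. -/
theorem dirDeriv_and_tanHess_of_curve (hr : 0 < r) {f : Metric.sphere (0 : E) r → G}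
    (hf : IsSmooth f) (p : Metric.sphere (0 : E) r) (w : Tan p) (hw : ‖w‖ = r) {c c' : ℝ → G}
    {c'' : G} (h : ∀ θ, f ⟨_, norm_greatCircle p w hw θ⟩ = c θ) (h1 : ∀ θ, HasDerivAt c (c' θ) θ)
    (h2 : HasDerivAt c' c'' 0) : dirDeriv f p w = c' 0 ∧ tanHess f p w w = c'' := by
  have e : (fun t => radialExt f (greatCircle (p : E) w t)) = c :=
    funext fun θ => (radialExt_coe f ⟨_, norm_greatCircle p w hw θ⟩).trans (h θ)
  have e' : deriv c = c' := funext fun θ => (h1 θ).deriv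
  have a := hasDerivAt_comp_greatCircle_zero hr hf p w hw
  have b := hasDerivAt_deriv_comp_greatCircle hr hf p w hw
  rw [e] at a b
  rw [e'] at b
  exact ⟨a.unique (h1 0), b.unique h2⟩

end GeneralSphere

/-! ### The rotating frame of the Hopf map and its Jacobi operator -/

section HopfFrame

/-- Euclidean four-space. -/
abbrev E4 : Type := EuclideanSpace ℝ (Fin 4)

/-- Euclidean three-space. -/
abbrev E3 : Type := EuclideanSpace ℝ (Fin 3)

theorem sqrt_two_pos : (0 : ℝ) < √2 := by positivity

/-- The vertical vector field of length `√2`. -/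
def T₁ (x : S3) : Tan x :=
  ⟨!₂[-x.1 1, x.1 0, -x.1 3, x.1 2], by
    rw [mem_Tan]
    simp [PiLp.inner_apply, Fin.sum_univ_four]
    ring⟩

/-- `√2 X₂`. -/
def T₂ (x : S3) : Tan x :=
  ⟨!₂[-x.1 2, x.1 3, x.1 0, -x.1 1], by
    rw [mem_Tan]
    simp [PiLp.inner_apply, Fin.sum_univ_four]
    ring⟩

/-- `√2 X₃`. -/
def T₃ (x : S3) : Tan x :=
  ⟨!₂[-x.1 3, -x.1 2, x.1 1, x.1 0], by
    rw [mem_Tan]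
    simp [PiLp.inner_apply, Fin.sum_univ_four]
    ring⟩

theorem X₂_eq (x : S3) : X₂ x = (1 / √2) • T₂ x := rfl

theorem X₃_eq (x : S3) : X₃ x = (1 / √2) • T₃ x := rfl

/-- The frame `T₁, T₂, T₃`. -/
def frameT (x : S3) : Fin 3 → Tan x := ![T₁ x, T₂ x, T₃ x]

theorem inner_frameT (x : S3) (i j : Fin 3) :
    inner ℝ (frameT x i) (frameT x j) = if i = j then (2 : ℝ) else 0 := by
  have h := S3_sum_sq x
  rw [Submodule.coe_inner, PiLp.inner_apply, Fin.sum_univ_four]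
  fin_cases i <;> fin_cases j <;> simp [frameT, T₁, T₂, T₃] <;> linarith

theorem norm_frameT (x : S3) (i : Fin 3) : ‖frameT x i‖ = √2 := by
  rw [norm_eq_sqrt_real_inner, inner_frameT, if_pos rfl]

theorem norm_T₁ (x : S3) : ‖T₁ x‖ = √2 := norm_frameT x 0
theorem norm_T₂ (x : S3) : ‖T₂ x‖ = √2 := norm_frameT x 1
theorem norm_T₃ (x : S3) : ‖T₃ x‖ = √2 := norm_frameT x 2

theorem one_div_sqrt_two_mul_self : (1 / √2) * (1 / √2) = (1 / 2 : ℝ) := by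
  rw [div_mul_div_comm, Real.mul_self_sqrt (by norm_num), one_mul]

theorem finrank_Tan (x : S3) : Module.finrank ℝ (Tan x) = 3 := by
  have : Fact (Module.finrank ℝ E4 = 3 + 1) := ⟨by simp⟩
  exact Submodule.finrank_orthogonal_span_singleton (sphere_ne_zero sqrt_two_pos x)

theorem orthonormal_frame (x : S3) : Orthonormal ℝ fun i => (1 / √2) • frameT x i := by
  rw [orthonormal_iff_ite]
  intro i j
  rw [inner_smul_left, inner_smul_right, inner_frameT, RCLike.conj_to_real, ← mul_assoc,
    one_div_sqrt_two_mul_self]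
  split_ifs <;> norm_num

/-- The orthonormal frame `T₁/√2, X₂, X₃`. -/
def frame (x : S3) : OrthonormalBasis (Fin 3) ℝ (Tan x) :=
  OrthonormalBasis.mk (orthonormal_frame x) (by
    rw [(orthonormal_frame x).linearIndependent.span_eq_top_of_card_eq_finrank' (by
      rw [finrank_Tan]; rfl)])

theorem frame_apply (x : S3) (i : Fin 3) : frame x i = (1 / √2) • frameT x i := by
  simp [frame]

theorem sum_frame (x : S3) {W : Type*} [AddCommGroup W] [Module ℝ W]
    (B : Tan x →ₗ[ℝ] Tan x →ₗ[ℝ] W) :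
    ∑ i, B (frame x i) (frame x i)
      = (1 / 2 : ℝ) • (B (T₁ x) (T₁ x) + B (T₂ x) (T₂ x) + B (T₃ x) (T₃ x)) := by
  simp only [frame_apply, map_smul, LinearMap.smul_apply, smul_smul, one_div_sqrt_two_mul_self,
    Fin.sum_univ_three, ← smul_add]
  rfl

theorem laplacian_frame {f : S3 → ℝ} (hf : IsSmooth f) (p : S3) :
    tanHess f p (T₁ p) (T₁ p) + tanHess f p (T₂ p) (T₂ p) + tanHess f p (T₃ p) (T₃ p)
      = -2 * laplacian f p := by
  rw [laplacian_eq_sum sqrt_two_pos hf p (frame p), sum_frame, smul_eq_mul]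
  ring

/-- `√2` times the Hopf map. -/
def normalMap (x : E4) : E3 :=
  (1 / 2 : ℝ) • !₂[2 * x 0 * x 2 + 2 * x 1 * x 3, 2 * x 1 * x 2 - 2 * x 0 * x 3,
    x 0 ^ 2 + x 1 ^ 2 - x 2 ^ 2 - x 3 ^ 2]

/-- The quadratic map extending `dψ(X₂)`. -/
def quadTwo (x : E4) : E3 :=
  (1 / 2 : ℝ) • !₂[x 0 ^ 2 - x 1 ^ 2 - x 2 ^ 2 + x 3 ^ 2, 2 * x 0 * x 1 + 2 * x 2 * x 3,
    -2 * x 0 * x 2 + 2 * x 1 * x 3]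

/-- The quadratic map extending `dψ(X₃)`. -/
def quadThree (x : E4) : E3 :=
  (1 / 2 : ℝ) • !₂[2 * x 0 * x 1 - 2 * x 2 * x 3, -x 0 ^ 2 + x 1 ^ 2 - x 2 ^ 2 + x 3 ^ 2,
    -2 * x 0 * x 3 - 2 * x 1 * x 2]

theorem contDiff_of_coord {h : E4 → E3} (hh : ∀ i, ContDiff ℝ ∞ fun x => h x i) :
    ContDiff ℝ ∞ h := contDiff_euclidean.2 hh

theorem contDiff_normalMap : ContDiff ℝ ∞ normalMap := by
  refine contDiff_of_coord fun i => ?_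
  fin_cases i <;> simp [normalMap] <;> fun_prop

theorem contDiff_quadTwo : ContDiff ℝ ∞ quadTwo := by
  refine contDiff_of_coord fun i => ?_
  fin_cases i <;> simp [quadTwo] <;> fun_prop

theorem contDiff_quadThree : ContDiff ℝ ∞ quadThree := by
  refine contDiff_of_coord fun i => ?_
  fin_cases i <;> simp [quadThree] <;> fun_prop

theorem isSmooth_normalMap : IsSmooth fun q : S3 => normalMap q :=
  isSmooth_restrict sqrt_two_pos (fun _ => rfl) contDiff_normalMap.contDiffOn

theorem isSmooth_quadTwo : IsSmooth fun q : S3 => quadTwo q :=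
  isSmooth_restrict sqrt_two_pos (fun _ => rfl) contDiff_quadTwo.contDiffOn

theorem isSmooth_quadThree : IsSmooth fun q : S3 => quadThree q :=
  isSmooth_restrict sqrt_two_pos (fun _ => rfl) contDiff_quadThree.contDiffOn

/-- Rotation of `A` towards `B` with double speed. -/
def rotCurve (A B : E3) (θ : ℝ) : E3 := Real.cos (2 * θ) • A + Real.sin (2 * θ) • B

theorem hasDerivAt_rotCurve (A B : E3) (θ : ℝ) :
    HasDerivAt (rotCurve A B) ((2 : ℝ) • rotCurve B (-A) θ) θ := by
  have h : HasDerivAt (fun t : ℝ => 2 * t) 2 θ := by simpa using (hasDerivAt_id θ).const_mul 2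
  have h1 := (h.cos.smul_const A).fun_add (h.sin.smul_const B)
  exact h1.congr_deriv (by simp only [rotCurve]; module)

/-- Rotation by the angle `2θ` gives velocity `2B` and acceleration `-4A` at `θ = 0`. -/
theorem derivs_of_rotCurve {h : E4 → E3} (hs : IsSmooth fun q : S3 => h q) (p : S3) (w : Tan p)
    (hw : ‖w‖ = √2) {A B : E3} (hc : ∀ θ, h (greatCircle (p : E4) w θ) = rotCurve A B θ) :
    dirDeriv (fun q : S3 => h q) p w = (2 : ℝ) • B ∧
      tanHess (fun q : S3 => h q) p w w = (-4 : ℝ) • A := by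
  have h2 : HasDerivAt (fun θ => (2 : ℝ) • rotCurve B (-A) θ) ((2 : ℝ) • (2 : ℝ) • rotCurve (-A) (-B) 0) 0 :=
    (hasDerivAt_rotCurve B (-A) 0).const_smul (2 : ℝ)
  obtain ⟨a, b⟩ := dirDeriv_and_tanHess_of_curve sqrt_two_pos hs p w hw hc
    (hasDerivAt_rotCurve A B) h2
  rw [a, b]
  simp only [rotCurve, mul_zero, Real.cos_zero, Real.sin_zero]
  constructor <;> module

theorem derivs_of_const {h : E4 → E3} (hs : IsSmooth fun q : S3 => h q) (p : S3) (w : Tan p)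
    (hw : ‖w‖ = √2) {A : E3} (hc : ∀ θ, h (greatCircle (p : E4) w θ) = A) :
    dirDeriv (fun q : S3 => h q) p w = 0 ∧ tanHess (fun q : S3 => h q) p w w = 0 :=
  dirDeriv_and_tanHess_of_curve sqrt_two_pos hs p w hw hc (fun θ => hasDerivAt_const θ A)
    (hasDerivAt_const _ _)

/-- On the three-sphere, `normalMap`, `quadTwo` and `quadThree` form an orthonormal frame of
three-space; this is the double cover of the rotation group. Each great circle tangent to `T₁`, `T₂`
or `T₃` fixes one vector of the frame and turns the other two at double speed. These nine identities
provide every derivative needed below. -/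
theorem normalMap_circle_one (p : S3) (θ : ℝ) :
    normalMap (greatCircle (p : E4) (T₁ p) θ) = normalMap p := by
  have h := Real.sin_sq_add_cos_sq θ
  ext i
  fin_cases i <;> simp [normalMap, greatCircle, T₁]
  · linear_combination (2 * p.1 0 * p.1 2 + 2 * p.1 1 * p.1 3) * h
  · linear_combination (2 * p.1 1 * p.1 2 - 2 * p.1 0 * p.1 3) * h
  · linear_combination (p.1 0 ^ 2 + p.1 1 ^ 2 - p.1 2 ^ 2 - p.1 3 ^ 2) * h

theorem quadTwo_circle_one (p : S3) (θ : ℝ) :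
    quadTwo (greatCircle (p : E4) (T₁ p) θ) = rotCurve (quadTwo p) (-quadThree p) θ := by
  ext i
  fin_cases i <;>
    simp [quadTwo, quadThree, rotCurve, greatCircle, T₁, Real.cos_two_mul', Real.sin_two_mul] <;>
    ring

theorem quadThree_circle_one (p : S3) (θ : ℝ) :
    quadThree (greatCircle (p : E4) (T₁ p) θ) = rotCurve (quadThree p) (quadTwo p) θ := by
  ext i
  fin_cases i <;>
    simp [quadTwo, quadThree, rotCurve, greatCircle, T₁, Real.cos_two_mul', Real.sin_two_mul] <;>
    ring

theorem normalMap_circle_two (p : S3) (θ : ℝ) :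
    normalMap (greatCircle (p : E4) (T₂ p) θ) = rotCurve (normalMap p) (quadTwo p) θ := by
  ext i
  fin_cases i <;>
    simp [quadTwo, normalMap, rotCurve, greatCircle, T₂, Real.cos_two_mul', Real.sin_two_mul] <;>
    ring

theorem quadTwo_circle_two (p : S3) (θ : ℝ) :
    quadTwo (greatCircle (p : E4) (T₂ p) θ) = rotCurve (quadTwo p) (-normalMap p) θ := by
  ext i
  fin_cases i <;>
    simp [quadTwo, normalMap, rotCurve, greatCircle, T₂, Real.cos_two_mul', Real.sin_two_mul] <;>
    ring

theorem quadThree_circle_two (p : S3) (θ : ℝ) :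
    quadThree (greatCircle (p : E4) (T₂ p) θ) = quadThree p := by
  have h := Real.sin_sq_add_cos_sq θ
  ext i
  fin_cases i <;> simp [quadThree, greatCircle, T₂]
  · linear_combination (2 * p.1 0 * p.1 1 - 2 * p.1 2 * p.1 3) * h
  · linear_combination (-p.1 0 ^ 2 + p.1 1 ^ 2 - p.1 2 ^ 2 + p.1 3 ^ 2) * h
  · linear_combination (-2 * p.1 0 * p.1 3 - 2 * p.1 1 * p.1 2) * h

theorem normalMap_circle_three (p : S3) (θ : ℝ) :
    normalMap (greatCircle (p : E4) (T₃ p) θ) = rotCurve (normalMap p) (quadThree p) θ := by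
  ext i
  fin_cases i <;>
    simp [quadThree, normalMap, rotCurve, greatCircle, T₃, Real.cos_two_mul', Real.sin_two_mul] <;>
    ring

theorem quadTwo_circle_three (p : S3) (θ : ℝ) :
    quadTwo (greatCircle (p : E4) (T₃ p) θ) = quadTwo p := by
  have h := Real.sin_sq_add_cos_sq θ
  ext i
  fin_cases i <;> simp [quadTwo, greatCircle, T₃]
  · linear_combination (p.1 0 ^ 2 - p.1 1 ^ 2 - p.1 2 ^ 2 + p.1 3 ^ 2) * h
  · linear_combination (2 * p.1 0 * p.1 1 + 2 * p.1 2 * p.1 3) * h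
  · linear_combination (-2 * p.1 0 * p.1 2 + 2 * p.1 1 * p.1 3) * h

theorem quadThree_circle_three (p : S3) (θ : ℝ) :
    quadThree (greatCircle (p : E4) (T₃ p) θ) = rotCurve (quadThree p) (-normalMap p) θ := by
  ext i
  fin_cases i <;>
    simp [quadThree, normalMap, rotCurve, greatCircle, T₃, Real.cos_two_mul', Real.sin_two_mul] <;>
    ring

theorem hopf_coe (x : S3) : (hopf x : E3) = (1 / √2) • normalMap x := by
  rw [hopf, normalMap, smul_smul]
  field_simp

theorem isSmooth_hopf : IsSmooth fun q : S3 => (hopf q : E3) :=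
  isSmooth_restrict sqrt_two_pos hopf_coe (contDiff_normalMap.const_smul _).contDiffOn

theorem differential_hopf_coe (p : S3) (v : Tan p) :
    (differential hopf p v : E3) = (1 / √2) • dirDeriv (fun q : S3 => normalMap q) p v := by
  have h : HasFDerivAt normalMap (fderiv ℝ normalMap p) (p : E4) :=
    (contDiff_normalMap.differentiable (by simp) p).hasFDerivAt
  have h1 := dirDeriv_restrict sqrt_two_pos (f := fun q => (hopf q : E3)) hopf_coe p
    (h.const_smul (1 / √2)) v
  have h2 := dirDeriv_restrict sqrt_two_pos (f := fun q : S3 => normalMap q) (fun _ => rfl) p h v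
  rw [h2]
  exact h1

theorem differential_hopf_T₁ (p : S3) : differential hopf p (T₁ p) = 0 := by
  ext1
  rw [differential_hopf_coe,
    (derivs_of_const isSmooth_normalMap p (T₁ p) (norm_T₁ p) (normalMap_circle_one p)).1]
  simp

theorem one_div_sqrt_two_smul_two_smul (y : E3) : (1 / √2) • (2 : ℝ) • y = √2 • y := by
  rw [smul_smul, div_mul_eq_mul_div, one_mul, Real.div_sqrt]

theorem differential_hopf_T₂ (p : S3) : (differential hopf p (T₂ p) : E3) = √2 • quadTwo p := by
  rw [differential_hopf_coe, ← one_div_sqrt_two_smul_two_smul,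
    (derivs_of_rotCurve isSmooth_normalMap p (T₂ p) (norm_T₂ p) (normalMap_circle_two p)).1]

theorem differential_hopf_T₃ (p : S3) : (differential hopf p (T₃ p) : E3) = √2 • quadThree p := by
  rw [differential_hopf_coe, ← one_div_sqrt_two_smul_two_smul,
    (derivs_of_rotCurve isSmooth_normalMap p (T₃ p) (norm_T₃ p) (normalMap_circle_three p)).1]

/-- `dψ(X₂)`. -/
def V₂ (p : S3) : Tan (hopf p) := differential hopf p (X₂ p)

/-- `dψ(X₃)`. -/
def V₃ (p : S3) : Tan (hopf p) := differential hopf p (X₃ p)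

theorem V₂_coe (p : S3) : (V₂ p : E3) = quadTwo p := by
  rw [V₂, X₂_eq, map_smul, Submodule.coe_smul, differential_hopf_T₂, smul_smul,
    one_div_mul_cancel sqrt_two_pos.ne', one_smul]

theorem V₃_coe (p : S3) : (V₃ p : E3) = quadThree p := by
  rw [V₃, X₃_eq, map_smul, Submodule.coe_smul, differential_hopf_T₃, smul_smul,
    one_div_mul_cancel sqrt_two_pos.ne', one_smul]

theorem differential_T₂_eq (p : S3) : differential hopf p (T₂ p) = √2 • V₂ p :=
  Subtype.ext (by rw [differential_hopf_T₂, Submodule.coe_smul, V₂_coe])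

theorem differential_T₃_eq (p : S3) : differential hopf p (T₃ p) = √2 • V₃ p :=
  Subtype.ext (by rw [differential_hopf_T₃, Submodule.coe_smul, V₃_coe])

theorem inner_V₂_V₂ (p : S3) : inner ℝ (V₂ p) (V₂ p) = (1 : ℝ) := by
  have h := S3_sum_sq p
  rw [Submodule.coe_inner, V₂_coe, quadTwo, PiLp.inner_apply, Fin.sum_univ_three]
  simp [mul_pow]
  linear_combination (1 / 4) * (p.1 0 ^ 2 + p.1 1 ^ 2 + p.1 2 ^ 2 + p.1 3 ^ 2 + 2) * h

theorem inner_V₃_V₃ (p : S3) : inner ℝ (V₃ p) (V₃ p) = (1 : ℝ) := by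
  have h := S3_sum_sq p
  rw [Submodule.coe_inner, V₃_coe, quadThree, PiLp.inner_apply, Fin.sum_univ_three]
  simp [mul_pow]
  linear_combination (1 / 4) * (p.1 0 ^ 2 + p.1 1 ^ 2 + p.1 2 ^ 2 + p.1 3 ^ 2 + 2) * h

theorem inner_V₂_V₃ (p : S3) : inner ℝ (V₂ p) (V₃ p) = (0 : ℝ) := by
  rw [Submodule.coe_inner, V₂_coe, V₃_coe]
  simp [quadTwo, quadThree, PiLp.inner_apply, Fin.sum_univ_three]
  ring

theorem combination_V_eq_zero {p : S3} {a b : ℝ} (h : a • V₂ p + b • V₃ p = 0) :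
    a = 0 ∧ b = 0 := by
  have h2 := congrArg (inner ℝ (V₂ p)) h
  have h3 := congrArg (inner ℝ (V₃ p)) h
  simp only [inner_add_right, inner_smul_right, inner_V₂_V₂, inner_V₂_V₃, inner_V₃_V₃,
    real_inner_comm (V₂ p) (V₃ p), inner_zero_right] at h2 h3
  constructor <;> linarith

section Field

variable {f₂ f₃ : S3 → ℝ} {X : ∀ p : S3, Tan p}

theorem differential_field (hX : ∀ p, X p = f₂ p • X₂ p + f₃ p • X₃ p) (p : S3) :
    differential hopf p (X p) = f₂ p • V₂ p + f₃ p • V₃ p := by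
  rw [hX, map_add, map_smul, map_smul]; rfl

theorem differential_field_coe (hX : ∀ p, X p = f₂ p • X₂ p + f₃ p • X₃ p) (p : S3) :
    (differential hopf p (X p) : E3) = f₂ p • quadTwo p + f₃ p • quadThree p := by
  rw [differential_field hX, Submodule.coe_add, Submodule.coe_smul, Submodule.coe_smul, V₂_coe,
    V₃_coe]

theorem isSmooth_differential_field (hf₂ : IsSmooth f₂) (hf₃ : IsSmooth f₃)
    (hX : ∀ p, X p = f₂ p • X₂ p + f₃ p • X₃ p) :
    IsSmooth fun p => (differential hopf p (X p) : E3) := by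
  rw [show (fun p => (differential hopf p (X p) : E3)) = _ from
    funext (differential_field_coe hX)]
  exact (hf₂.smul isSmooth_quadTwo).add (hf₃.smul isSmooth_quadThree)

theorem projection_normalMap (p : S3) :
    (Tan (hopf p)).orthogonalProjectionOnto (normalMap p) = 0 := by
  have h : normalMap p = √2 • (hopf p : E3) := by
    rw [hopf_coe, smul_smul, mul_one_div_cancel sqrt_two_pos.ne', one_smul]
  rw [h, projection_Tan_self]

theorem projection_quadTwo (p : S3) :
    (Tan (hopf p)).orthogonalProjectionOnto (quadTwo p) = V₂ p := by
  rw [← V₂_coe, projection_Tan_coe]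

theorem projection_quadThree (p : S3) :
    (Tan (hopf p)).orthogonalProjectionOnto (quadThree p) = V₃ p := by
  rw [← V₃_coe, projection_Tan_coe]

/-- The Jacobi operator of the Hopf map on `dψ(f₂ X₂ + f₃ X₃)`. -/
theorem jacobiOperator_hopf (hf₂ : IsSmooth f₂) (hf₃ : IsSmooth f₃)
    (hX : ∀ p, X p = f₂ p • X₂ p + f₃ p • X₃ p) (p : S3) :
    jacobiOperator hopf (fun p => differential hopf p (X p)) p
      = (laplacian f₂ p - 2 * dirDeriv f₃ p (T₁ p)) • V₂ p
        + (laplacian f₃ p + 2 * dirDeriv f₂ p (T₁ p)) • V₃ p := by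
  have hs := sqrt_two_pos
  have key : ∀ w : Tan p, ‖w‖ = √2 →
      tanHess (fun p => (differential hopf p (X p) : E3)) p w w
        = (tanHess f₂ p w w • quadTwo p
            + (2 * dirDeriv f₂ p w) • dirDeriv (fun q : S3 => quadTwo q) p w
            + f₂ p • tanHess (fun q : S3 => quadTwo q) p w w)
          + (tanHess f₃ p w w • quadThree p
            + (2 * dirDeriv f₃ p w) • dirDeriv (fun q : S3 => quadThree q) p w
            + f₃ p • tanHess (fun q : S3 => quadThree q) p w w) := by
    intro w hw
    rw [show (fun p => (differential hopf p (X p) : E3)) = _ from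
      funext (differential_field_coe hX), tanHess_add hs (hf₂.smul isSmooth_quadTwo)
        (hf₃.smul isSmooth_quadThree) p w hw, tanHess_smul hs hf₂ isSmooth_quadTwo p w hw,
      tanHess_smul hs hf₃ isSmooth_quadThree p w hw]
  obtain ⟨a21, b21⟩ :=
    derivs_of_rotCurve isSmooth_quadTwo p (T₁ p) (norm_T₁ p) (quadTwo_circle_one p)
  obtain ⟨a31, b31⟩ :=
    derivs_of_rotCurve isSmooth_quadThree p (T₁ p) (norm_T₁ p) (quadThree_circle_one p)
  obtain ⟨a22, b22⟩ :=
    derivs_of_rotCurve isSmooth_quadTwo p (T₂ p) (norm_T₂ p) (quadTwo_circle_two p)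
  obtain ⟨a32, b32⟩ :=
    derivs_of_const isSmooth_quadThree p (T₂ p) (norm_T₂ p) (quadThree_circle_two p)
  obtain ⟨a23, b23⟩ :=
    derivs_of_const isSmooth_quadTwo p (T₃ p) (norm_T₃ p) (quadTwo_circle_three p)
  obtain ⟨a33, b33⟩ :=
    derivs_of_rotCurve isSmooth_quadThree p (T₃ p) (norm_T₃ p) (quadThree_circle_three p)
  have l2 := laplacian_frame hf₂ p
  have l3 := laplacian_frame hf₃ p
  have hs2 : (1 / √2 : ℝ) ^ 2 = 1 / 2 := by rw [sq, one_div_sqrt_two_mul_self]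
  -- The energy density: `ψ` is a Riemannian submersion onto a surface, so `|dψ|² = 2`. With `1 / s²
  -- = 2` the curvature part contributes `-4V`.
  have hd : ∑ i, inner ℝ (differential hopf p (frame p i)) (differential hopf p (frame p i))
      = (2 : ℝ) := by
    have := sum_frame p ((innerₗ (Tan (hopf p))).compl₁₂ (differential hopf p) (differential hopf p))
    simp only [LinearMap.compl₁₂_apply, innerₗ_apply_apply] at this
    rw [this, differential_hopf_T₁, differential_T₂_eq, differential_T₃_eq]
    simp only [inner_smul_left, inner_smul_right, inner_V₂_V₂, inner_V₃_V₃, RCLike.conj_to_real,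
      inner_zero_left]
    simp only [mul_one, Real.mul_self_sqrt zero_le_two, smul_eq_mul]
    norm_num
  rw [jacobiOperator_eq_sum hs (by positivity) isSmooth_hopf
    (isSmooth_differential_field hf₂ hf₃ hX) p (frame p), ← Finset.sum_smul, hd, sum_frame,
    key _ (norm_T₁ p), key _ (norm_T₂ p), key _ (norm_T₃ p), a21, b21, a31, b31, a22, b22, a32,
    b32, a23, b23, a33, b33, differential_field hX, hs2]
  -- The projection kills the first derivatives of the frame along `T₂` and `T₃`, which are normal
  -- or zero; so only the cross terms along `T₁` remain. The second derivatives of the frame add up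
  -- to `+4V`, against the `-4V` of the curvature.
  simp only [map_add, map_smul, map_neg, map_zero, smul_zero, projection_normalMap,
    projection_quadTwo, projection_quadThree]
  have e2 : laplacian f₂ p = -(1 / 2) * (tanHess f₂ p (T₁ p) (T₁ p) + tanHess f₂ p (T₂ p) (T₂ p)
    + tanHess f₂ p (T₃ p) (T₃ p)) := by linarith
  have e3 : laplacian f₃ p = -(1 / 2) * (tanHess f₃ p (T₁ p) (T₁ p) + tanHess f₃ p (T₂ p) (T₂ p)
    + tanHess f₃ p (T₃ p) (T₃ p)) := by linarith
  rw [e2, e3]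
  module

theorem mem_jacobiKernel_iff (hf₂ : IsSmooth f₂) (hf₃ : IsSmooth f₃)
    (hX : ∀ p, X p = f₂ p • X₂ p + f₃ p • X₃ p) {c : ℝ}
    (he₂ : ∀ p, laplacian f₂ p = c * f₂ p) (he₃ : ∀ p, laplacian f₃ p = c * f₃ p) :
    (fun p => differential hopf p (X p)) ∈ jacobiKernel hopf ↔
      ∀ p, dirDeriv f₂ p (T₁ p) = -(c / 2 * f₃ p) ∧ dirDeriv f₃ p (T₁ p) = c / 2 * f₂ p := by
  constructor
  · rintro ⟨-, h⟩ p
    have h1 := h p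
    rw [jacobiOperator_hopf hf₂ hf₃ hX, he₂, he₃] at h1
    obtain ⟨a, b⟩ := combination_V_eq_zero h1
    constructor <;> linarith
  · refine fun h => ⟨isSmooth_differential_field hf₂ hf₃ hX, fun p => ?_⟩
    rw [jacobiOperator_hopf hf₂ hf₃ hX, he₂, he₃, (h p).1, (h p).2]
    module

end Field

end HopfFrame

/-! ### Maximum principles on the three-sphere -/

section MaximumPrinciple

instance : Nonempty S3 := ⟨⟨!₂[√2, 0, 0, 0], by
  rw [mem_sphere_zero_iff_norm, EuclideanSpace.norm_eq]
  simp [Fin.sum_univ_four]⟩⟩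

theorem exists_max {f : S3 → ℝ} (hf : IsSmooth f) : ∃ p, ∀ q, f q ≤ f p := by
  obtain ⟨p, -, hp⟩ := isCompact_univ.exists_isMaxOn (Set.univ_nonempty (α := S3))
    (hf.continuous sqrt_two_pos).continuousOn
  exact ⟨p, fun q => hp (Set.mem_univ q)⟩

theorem isSmooth_const (c : ℝ) : IsSmooth fun _ : S3 => c :=
  isSmooth_restrict sqrt_two_pos (g := fun _ => c) (fun _ => rfl) contDiffOn_const

theorem tanHess_const_smul {f : S3 → ℝ} (hf : IsSmooth f) (c : ℝ) (p : S3) (w : Tan p)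
    (hw : ‖w‖ = √2) : tanHess (fun q => c * f q) p w w = c * tanHess f p w w := by
  have h : HasDerivAt (deriv fun t => radialExt (fun q => c * f q) (greatCircle (p : E4) w t))
      (c * tanHess f p w w) 0 := by
    have e : (deriv fun t => radialExt (fun q => c * f q) (greatCircle (p : E4) w t))
        = fun t => c * deriv (fun t => radialExt f (greatCircle (p : E4) w t)) t := by
      funext t
      have e' : (fun t => radialExt (fun q => c * f q) (greatCircle (p : E4) w t))
          = fun t => c * radialExt f (greatCircle (p : E4) w t) := by
        funext t
        have h1 := radialExt_coe (fun q => c * f q) ⟨_, norm_greatCircle p w hw t⟩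
        have h2 := radialExt_coe f ⟨_, norm_greatCircle p w hw t⟩
        simp only at h1 h2
        rw [h1, h2]
      rw [e']
      exact deriv_const_mul_field c
    rw [e]
    exact (hasDerivAt_deriv_comp_greatCircle sqrt_two_pos hf p w hw).const_mul c
  have hs : IsSmooth fun q => c * f q := (isSmooth_const c).smul hf
  exact (hasDerivAt_deriv_comp_greatCircle sqrt_two_pos hs p w hw).unique h

/-- At a maximum the left side of `h` is nonpositive, so the maximum value cannot be positive. -/
theorem nonpos_of_horizontal {f : S3 → ℝ} (hf : IsSmooth f) {c : ℝ} (hc : 0 < c)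
    (h : ∀ p, tanHess f p (T₂ p) (T₂ p) + tanHess f p (T₃ p) (T₃ p) = c * f p) (p : S3) :
    f p ≤ 0 := by
  obtain ⟨m, hm⟩ := exists_max hf
  refine (hm p).trans ?_
  have h2 := tanHess_nonpos_of_isMax sqrt_two_pos hf m hm (T₂ m) (norm_T₂ m)
  have h3 := tanHess_nonpos_of_isMax sqrt_two_pos hf m hm (T₃ m) (norm_T₃ m)
  have := h m
  by_contra! hpos
  have := mul_pos hc hpos
  linarith

/-- The horizontal Laplacian `X₂² + X₃²` has no positive eigenvalue. -/
theorem eq_zero_of_horizontal {f : S3 → ℝ} (hf : IsSmooth f) {c : ℝ} (hc : 0 < c)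
    (h : ∀ p, tanHess f p (T₂ p) (T₂ p) + tanHess f p (T₃ p) (T₃ p) = c * f p) (p : S3) :
    f p = 0 := by
  refine le_antisymm (nonpos_of_horizontal hf hc h p) ?_
  have hn : IsSmooth fun q => (-1) * f q := (isSmooth_const (-1)).smul hf
  have := nonpos_of_horizontal hn hc (fun q => by
    rw [tanHess_const_smul hf _ _ _ (norm_T₂ q), tanHess_const_smul hf _ _ _ (norm_T₃ q)]
    linarith [h q]) p
  linarith

/-- The barrier function `q ↦ exp(α ⟨q, p₀⟩)`. -/
def barrier (α : ℝ) (p₀ q : S3) : ℝ := Real.exp (α * inner ℝ (q : E4) (p₀ : E4))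

theorem isSmooth_barrier (α : ℝ) (p₀ : S3) : IsSmooth (barrier α p₀) :=
  isSmooth_restrict sqrt_two_pos (g := fun x : E4 => Real.exp (α * inner ℝ x (p₀ : E4)))
    (fun _ => rfl)
    (Real.contDiff_exp.comp (contDiff_const.mul (contDiff_id.inner ℝ contDiff_const))).contDiffOn

theorem tanHess_barrier (α : ℝ) (p₀ p : S3) (w : Tan p) (hw : ‖w‖ = √2) :
    tanHess (barrier α p₀) p w w
      = barrier α p₀ p * ((α * inner ℝ (w : E4) (p₀ : E4)) ^ 2
        - α * inner ℝ (p : E4) (p₀ : E4)) := by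
  set t : ℝ := inner ℝ (p : E4) (p₀ : E4) with ht
  set u : ℝ := inner ℝ (w : E4) (p₀ : E4) with hu
  have hl : ∀ a b θ : ℝ, HasDerivAt (fun θ => α * (Real.cos θ * a + Real.sin θ * b))
      (α * (-Real.sin θ * a + Real.cos θ * b)) θ := fun a b θ =>
    (((Real.hasDerivAt_cos θ).mul_const a).add ((Real.hasDerivAt_sin θ).mul_const b)).const_mul α
  have h1 : ∀ θ, HasDerivAt (fun θ => Real.exp (α * (Real.cos θ * t + Real.sin θ * u)))
      (Real.exp (α * (Real.cos θ * t + Real.sin θ * u))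
        * (α * (Real.cos θ * u + Real.sin θ * (-t)))) θ := fun θ =>
    (hl t u θ).exp.congr_deriv (by ring)
  have h2 := (h1 0).mul (hl u (-t) 0)
  refine (dirDeriv_and_tanHess_of_curve sqrt_two_pos (isSmooth_barrier α p₀) p w hw
    (fun θ => ?_) h1 h2).2.trans ?_
  · simp only [barrier, greatCircle, inner_add_left, inner_smul_left, RCLike.conj_to_real, ht, hu]
  · simp [barrier, ← ht]
    ring

theorem sum_sq_inner_frame (p p₀ : S3) :
    inner ℝ (T₁ p : E4) (p₀ : E4) ^ 2 + inner ℝ (T₂ p : E4) (p₀ : E4) ^ 2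
      + inner ℝ (T₃ p : E4) (p₀ : E4) ^ 2 = 4 - inner ℝ (p : E4) (p₀ : E4) ^ 2 := by
  have h := S3_sum_sq p
  have h0 := S3_sum_sq p₀
  simp only [T₁, T₂, T₃, PiLp.inner_apply, Fin.sum_univ_four]
  simp
  linear_combination (p₀.1 0 ^ 2 + p₀.1 1 ^ 2 + p₀.1 2 ^ 2 + p₀.1 3 ^ 2) * h + 2 * h0

/-- Harmonic functions on the three-sphere are constant. -/
theorem harmonic_const {f : S3 → ℝ} (hf : IsSmooth f) (h : ∀ p, laplacian f p = 0) (p q : S3) :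
    f p = f q := by
  -- Strong maximum principle by a barrier. If `f p₀ < f m`, add a small multiple of `barrier α p₀`,
  -- chosen so that the maximum of the sum stays away from `p₀`, where the barrier is strictly
  -- subharmonic. Since `f` is harmonic, the trace of the Hessian at that maximum would be positive.
  obtain ⟨m, hm⟩ := exists_max hf
  suffices H : ∀ p, f m ≤ f p from
    (le_antisymm (hm p) (H p)).trans (le_antisymm (hm q) (H q)).symm
  clear p q
  intro p₀
  by_contra! hlt
  obtain ⟨b, hb1, hb2⟩ := exists_between hlt
  obtain ⟨ε, hε, hball⟩ := Metric.mem_nhds_iff.1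
    ((hf.continuous sqrt_two_pos).continuousAt (x := p₀) |>.eventually_lt_const hb1)
  have hfar : ∀ x : S3, b ≤ f x → inner ℝ (x : E4) (p₀ : E4) ≤ 2 - ε ^ 2 / 2 := by
    intro x hx
    have hd : ε ≤ ‖(x : E4) - p₀‖ := by
      by_contra! hc
      have : x ∈ Metric.ball p₀ ε := by
        rw [Metric.mem_ball, Subtype.dist_eq, dist_eq_norm]; exact hc
      exact absurd (hball this) (not_lt.2 hx)
    have h1 := norm_sub_sq_real (x : E4) (p₀ : E4)
    rw [norm_coe_sphere, norm_coe_sphere, Real.sq_sqrt zero_le_two] at h1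
    have h2 := pow_le_pow_left₀ hε.le hd 2
    linarith
  -- Away from `p₀` one has `t ≤ 2 - ε²/2`, so `4 - t² ≥ ε²` when `t ≥ 0`; then `α (4 - t²) ≥ 8 > 6
  -- ≥ 3t`, which is strict subharmonicity.
  set α : ℝ := 8 / ε ^ 2 with hα
  have hα0 : 0 < α := by positivity
  have hαε : α * ε ^ 2 = 8 := by rw [hα]; field_simp
  have hsq : ∀ x : S3, inner ℝ (x : E4) (p₀ : E4) ^ 2 ≤ (4 : ℝ) := fun x => by
    nlinarith [sum_sq_inner_frame x p₀, sq_nonneg (inner ℝ (T₁ x : E4) (p₀ : E4)),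
      sq_nonneg (inner ℝ (T₂ x : E4) (p₀ : E4)), sq_nonneg (inner ℝ (T₃ x : E4) (p₀ : E4))]
  set K : ℝ := Real.exp (α * 2) with hK
  have hK0 : 0 < K := Real.exp_pos _
  have hb0 : ∀ x, 0 < barrier α p₀ x := fun x => Real.exp_pos _
  have hbK : ∀ x, barrier α p₀ x ≤ K := fun x =>
    Real.exp_le_exp.2 (mul_le_mul_of_nonneg_left (by nlinarith [hsq x]) hα0.le)
  -- As `K` bounds the barrier, this `η` forces `f ≥ b` at any maximum point of the perturbed
  -- function.
  set η : ℝ := (f m - b) / K with hη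
  have hη0 : 0 < η := div_pos (sub_pos.2 hb2) hK0
  have hηK : η * K = f m - b := div_mul_cancel₀ _ hK0.ne'
  have hsb : IsSmooth fun q => η * barrier α p₀ q :=
    (isSmooth_const η).smul (isSmooth_barrier α p₀)
  have hu := hf.add hsb
  obtain ⟨x, hx⟩ := exists_max hu
  have hbx : b ≤ f x := by
    have h1 := hx m
    have h2 := mul_pos hη0 (hb0 m)
    have h3 := mul_le_mul_of_nonneg_left (hbK x) hη0.le
    linarith
  have key : ∀ w : Tan x, ‖w‖ = √2 → tanHess f x w w + η * (barrier α p₀ x *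
      ((α * inner ℝ (w : E4) (p₀ : E4)) ^ 2 - α * inner ℝ (x : E4) (p₀ : E4))) ≤ 0 := by
    intro w hw
    have := tanHess_nonpos_of_isMax sqrt_two_pos hu x hx w hw
    rwa [tanHess_add sqrt_two_pos hf hsb x w hw, tanHess_const_smul (isSmooth_barrier α p₀) η x w hw,
      tanHess_barrier α p₀ x w hw] at this
  have k1 := key _ (norm_T₁ x)
  have k2 := key _ (norm_T₂ x)
  have k3 := key _ (norm_T₃ x)
  have hl := laplacian_frame hf x
  rw [h x] at hl
  have hs := sum_sq_inner_frame x p₀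
  have hfx := hfar x hbx
  have hsx := hsq x
  set t : ℝ := inner ℝ (x : E4) (p₀ : E4)
  have hpos : 0 < α * (4 - t ^ 2) - 3 * t := by
    rcases lt_or_ge t 0 with ht | ht
    · have := mul_nonneg hα0.le (sub_nonneg.2 hsx)
      linarith
    · have h1 : ε ^ 2 ≤ 4 - t ^ 2 := by nlinarith
      have h2 := mul_le_mul_of_nonneg_left h1 hα0.le
      have h3 : 0 < ε ^ 2 := by positivity
      linarith
  have hpos2 := mul_pos (mul_pos hη0 (hb0 x)) (mul_pos hα0 hpos)
  have hsum : η * barrier α p₀ x * (α * (α * (4 - t ^ 2) - 3 * t)) ≤ 0 := by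
    rw [← hs]
    linarith
  linarith

theorem dirDeriv_eq_zero_of_harmonic {f : S3 → ℝ} (hf : IsSmooth f) (h : ∀ p, laplacian f p = 0)
    (p : S3) (v : Tan p) : dirDeriv f p v = 0 := by
  rw [dirDeriv_restrict sqrt_two_pos (g := fun _ => f p) (fun q => harmonic_const hf h q p) p
    (hasFDerivAt_const _ _)]
  rfl

end MaximumPrinciple

/-! ### Hopf fibres and rotation along them -/

section Fibres

/-- The circle action on the three-sphere, whose orbits are the fibres of the Hopf map. -/
def fibre (p : S3) (θ : ℝ) : S3 := ⟨_, norm_greatCircle p (T₁ p) (norm_T₁ p) θ⟩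

theorem T₁_fibre (p : S3) (θ : ℝ) :
    (T₁ (fibre p θ) : E4) = -Real.sin θ • (p : E4) + Real.cos θ • (T₁ p : E4) := by
  ext i
  fin_cases i <;> simp [T₁, fibre, greatCircle] <;> ring

theorem fibre_zero (p : S3) : fibre p 0 = p := Subtype.ext (by simp [fibre, greatCircle])

theorem fibre_two_pi (p : S3) : fibre p (2 * Real.pi) = p :=
  Subtype.ext (by simp [fibre, greatCircle])

theorem hopf_fibre (p : S3) (θ : ℝ) : hopf (fibre p θ) = hopf p :=
  Subtype.ext (by rw [hopf_coe, hopf_coe]; exact congrArg _ (normalMap_circle_one p θ))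

theorem hasDerivAt_fibre {G : Type*} [NormedAddCommGroup G] [NormedSpace ℝ G] {f : S3 → G}
    (hf : IsSmooth f) (p : S3) (θ : ℝ) :
    HasDerivAt (fun θ => f (fibre p θ)) (dirDeriv f (fibre p θ) (T₁ (fibre p θ))) θ := by
  have h := hasDerivAt_comp_greatCircle sqrt_two_pos hf p (T₁ p) (norm_T₁ p) θ
  rw [← T₁_fibre] at h
  have e : (fun θ => f (fibre p θ)) = fun t => radialExt f (greatCircle (p : E4) (T₁ p) t) :=
    funext fun t => (radialExt_coe f (fibre p t)).symm
  rw [e]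
  exact h

theorem exists_cos_sin {c s : ℝ} (h : c ^ 2 + s ^ 2 = 1) :
    ∃ θ : ℝ, Real.cos θ = c ∧ Real.sin θ = s := by
  have hn : ‖(⟨c, s⟩ : ℂ)‖ = 1 := by
    rw [← sq_eq_sq₀ (norm_nonneg _) zero_le_one, Complex.sq_norm, Complex.normSq_mk]
    linarith
  refine ⟨Complex.arg ⟨c, s⟩, ?_, ?_⟩
  · simpa [hn] using Complex.norm_mul_cos_arg ⟨c, s⟩
  · simpa [hn] using Complex.norm_mul_sin_arg ⟨c, s⟩

/-- The fibres of the Hopf map are the orbits of the circle action. -/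
theorem exists_fibre_of_hopf_eq {p q : S3} (h : hopf p = hopf q) : ∃ θ, q = fibre p θ := by
  have h0 : normalMap q = normalMap p := by
    have := congrArg (fun y : S2 => √2 • (y : E3)) h
    simp only [hopf_coe, smul_smul, mul_one_div_cancel sqrt_two_pos.ne', one_smul] at this
    exact this.symm
  have a0 := congrArg (fun y : E3 => y 0) h0
  have a1 := congrArg (fun y : E3 => y 1) h0
  have a2 := congrArg (fun y : E3 => y 2) h0
  simp [normalMap] at a0 a1 a2
  have hp := S3_sum_sq p
  have hq := S3_sum_sq q
  -- If `q = cos θ p + sin θ T₁ p`, the coefficients are `⟨p, q⟩ / 2` and `⟨T₁ p, q⟩ / 2`, since `p`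
  -- and `T₁ p` are orthogonal of squared length `2`.
  set c := (p.1 0 * q.1 0 + p.1 1 * q.1 1 + p.1 2 * q.1 2 + p.1 3 * q.1 3) / 2 with hc
  set s := (-p.1 1 * q.1 0 + p.1 0 * q.1 1 - p.1 3 * q.1 2 + p.1 2 * q.1 3) / 2 with hs
  have e0 : q.1 0 = c * p.1 0 + s * -p.1 1 := by
    rw [hc, hs]
    linear_combination (1 / 2) * (q.1 2 * (1 / 2) * a0 - q.1 3 * (1 / 2) * a1)
      + q.1 0 / 4 * (a2 - hp - hq)
  have e1 : q.1 1 = c * p.1 1 + s * p.1 0 := by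
    rw [hc, hs]
    linear_combination (1 / 2) * (q.1 2 * (1 / 2) * a1 + q.1 3 * (1 / 2) * a0)
      + q.1 1 / 4 * (a2 - hp - hq)
  have e2 : q.1 2 = c * p.1 2 + s * -p.1 3 := by
    rw [hc, hs]
    linear_combination (1 / 2) * (q.1 0 * (1 / 2) * a0 + q.1 1 * (1 / 2) * a1)
      + q.1 2 / 4 * (-a2 - hp - hq)
  have e3 : q.1 3 = c * p.1 3 + s * p.1 2 := by
    rw [hc, hs]
    linear_combination (1 / 2) * (q.1 1 * (1 / 2) * a0 - q.1 0 * (1 / 2) * a1)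
      + q.1 3 / 4 * (-a2 - hp - hq)
  have hcs : c ^ 2 + s ^ 2 = 1 := by
    rw [e0, e1, e2, e3] at hq
    linear_combination (1 / 2) * hq - (c ^ 2 + s ^ 2) / 2 * hp
  obtain ⟨θ, hθ1, hθ2⟩ := exists_cos_sin hcs
  refine ⟨θ, Subtype.ext ?_⟩
  ext i
  fin_cases i <;> simp only [fibre, greatCircle, T₁, hθ1, hθ2]
  · simpa using e0
  · simpa using e1
  · simpa using e2
  · simpa using e3

variable {f₂ f₃ : S3 → ℝ}

theorem tanHess_T₁_of_rotation (hf₂ : IsSmooth f₂) (hf₃ : IsSmooth f₃) {μ : ℝ}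
    (h₂ : ∀ p, dirDeriv f₂ p (T₁ p) = -(μ * f₃ p)) (h₃ : ∀ p, dirDeriv f₃ p (T₁ p) = μ * f₂ p)
    (p : S3) : tanHess f₂ p (T₁ p) (T₁ p) = -(μ * (μ * f₂ p)) := by
  have d2 : ∀ θ, HasDerivAt (fun θ => f₂ (fibre p θ)) (-(μ * f₃ (fibre p θ))) θ := fun θ =>
    (hasDerivAt_fibre hf₂ p θ).congr_deriv (h₂ _)
  have d3 : HasDerivAt (fun θ => -(μ * f₃ (fibre p θ))) (-(μ * (μ * f₂ p))) 0 :=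
    (((hasDerivAt_fibre hf₃ p 0).congr_deriv (h₃ _)).const_mul μ).neg.congr_deriv
      (by rw [fibre_zero])
  exact (dirDeriv_and_tanHess_of_curve sqrt_two_pos hf₂ p (T₁ p) (norm_T₁ p) (fun _ => rfl) d2
    d3).2

/-- The frequency of a rotation along the closed fibres is an integer. -/
theorem exists_int_of_rotation (hf₂ : IsSmooth f₂) (hf₃ : IsSmooth f₃) {μ : ℝ}
    (h₂ : ∀ p, dirDeriv f₂ p (T₁ p) = -(μ * f₃ p)) (h₃ : ∀ p, dirDeriv f₃ p (T₁ p) = μ * f₂ p)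
    {p : S3} (hp : ¬(f₂ p = 0 ∧ f₃ p = 0)) : ∃ n : ℤ, μ = n := by
  have d2 : ∀ θ, HasDerivAt (fun θ => f₂ (fibre p θ)) (-(μ * f₃ (fibre p θ))) θ := fun θ =>
    (hasDerivAt_fibre hf₂ p θ).congr_deriv (h₂ _)
  have d3 : ∀ θ, HasDerivAt (fun θ => f₃ (fibre p θ)) (μ * f₂ (fibre p θ)) θ := fun θ =>
    (hasDerivAt_fibre hf₃ p θ).congr_deriv (h₃ _)
  have hl : ∀ θ : ℝ, HasDerivAt (fun θ => μ * θ) μ θ := fun θ => by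
    simpa using (hasDerivAt_id θ).const_mul μ
  -- The functions in `e1` and `e2` are the real and imaginary parts of `exp(-iμθ)(f₂ + i f₃)`,
  -- which is constant along the fibre. Comparing `θ = 2π` with `θ = 0` gives `exp(-2πiμ) = 1`.
  have e1 : ∀ θ, HasDerivAt (fun θ => Real.cos (μ * θ) * f₂ (fibre p θ)
      + Real.sin (μ * θ) * f₃ (fibre p θ)) 0 θ := fun θ =>
    (((hl θ).cos.mul (d2 θ)).add ((hl θ).sin.mul (d3 θ))).congr_deriv (by ring)
  have e2 : ∀ θ, HasDerivAt (fun θ => Real.cos (μ * θ) * f₃ (fibre p θ)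
      - Real.sin (μ * θ) * f₂ (fibre p θ)) 0 θ := fun θ =>
    (((hl θ).cos.mul (d3 θ)).sub ((hl θ).sin.mul (d2 θ))).congr_deriv (by ring)
  have c1 := is_const_of_deriv_eq_zero (fun θ => (e1 θ).differentiableAt)
    (fun θ => (e1 θ).deriv) (2 * Real.pi) 0
  have c2 := is_const_of_deriv_eq_zero (fun θ => (e2 θ).differentiableAt)
    (fun θ => (e2 θ).deriv) (2 * Real.pi) 0
  simp only [fibre_two_pi, fibre_zero, mul_zero, Real.cos_zero, Real.sin_zero, one_mul, zero_mul,
    add_zero, sub_zero] at c1 c2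
  set C := Real.cos (μ * (2 * Real.pi)) with hC
  have h : (C - 1) * (f₂ p ^ 2 + f₃ p ^ 2) = 0 := by
    linear_combination f₂ p * c1 + f₃ p * c2
  have hne : f₂ p ^ 2 + f₃ p ^ 2 ≠ 0 := fun h0 => hp ⟨by nlinarith, by nlinarith⟩
  have hC1 : C = 1 := sub_eq_zero.1 ((mul_eq_zero.1 h).resolve_right hne)
  obtain ⟨n, hn⟩ := (Real.cos_eq_one_iff _).1 hC1
  exact ⟨n, (mul_right_cancel₀ (by positivity : (2 * Real.pi) ≠ 0) hn).symm⟩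

end Fibres

/-! ### Basic fields as fields rotating at rate two -/

section Basic

variable {f₂ f₃ : S3 → ℝ} {X : ∀ p : S3, Tan p}

/-- The terms `± 2f` come from the frame itself turning at double speed along the fibre. Hence
`dψ(X)` is constant on fibres exactly when the coefficients rotate at rate `2`. -/
theorem dirDeriv_differential_field (hf₂ : IsSmooth f₂) (hf₃ : IsSmooth f₃)
    (hX : ∀ p, X p = f₂ p • X₂ p + f₃ p • X₃ p) (p : S3) :
    dirDeriv (fun p => (differential hopf p (X p) : E3)) p (T₁ p)
      = (((dirDeriv f₂ p (T₁ p) + 2 * f₃ p) • V₂ p + (dirDeriv f₃ p (T₁ p) - 2 * f₂ p) • V₃ p :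
        Tan (hopf p)) : E3) := by
  have hs := sqrt_two_pos
  rw [show (fun p => (differential hopf p (X p) : E3)) = _ from
    funext (differential_field_coe hX), dirDeriv_add hs (hf₂.smul isSmooth_quadTwo)
      (hf₃.smul isSmooth_quadThree), dirDeriv_smul hs hf₂ isSmooth_quadTwo,
    dirDeriv_smul hs hf₃ isSmooth_quadThree,
    (derivs_of_rotCurve isSmooth_quadTwo p (T₁ p) (norm_T₁ p) (quadTwo_circle_one p)).1,
    (derivs_of_rotCurve isSmooth_quadThree p (T₁ p) (norm_T₁ p) (quadThree_circle_one p)).1,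
    Submodule.coe_add, Submodule.coe_smul, Submodule.coe_smul, V₂_coe, V₃_coe]
  module

theorem rotation_of_isBasic (hf₂ : IsSmooth f₂) (hf₃ : IsSmooth f₃)
    (hX : ∀ p, X p = f₂ p • X₂ p + f₃ p • X₃ p) (hb : IsBasic hopf X) (p : S3) :
    dirDeriv f₂ p (T₁ p) = -(2 * f₃ p) ∧ dirDeriv f₃ p (T₁ p) = 2 * f₂ p := by
  obtain ⟨-, -, Y, -, hY⟩ := hb
  have h1 := hasDerivAt_fibre (isSmooth_differential_field hf₂ hf₃ hX) p 0
  have h2 : (fun θ => (differential hopf (fibre p θ) (X (fibre p θ)) : E3))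
      = fun _ => (Y (hopf p) : E3) := funext fun θ => by rw [hY, hopf_fibre]
  rw [h2, fibre_zero] at h1
  have h3 := h1.unique (hasDerivAt_const _ _)
  rw [dirDeriv_differential_field hf₂ hf₃ hX, Submodule.coe_eq_zero] at h3
  obtain ⟨a, b⟩ := combination_V_eq_zero h3
  constructor <;> linarith

theorem differential_eq_of_hopf_eq (hf₂ : IsSmooth f₂) (hf₃ : IsSmooth f₃)
    (hX : ∀ p, X p = f₂ p • X₂ p + f₃ p • X₃ p)
    (h₂ : ∀ p, dirDeriv f₂ p (T₁ p) = -(2 * f₃ p)) (h₃ : ∀ p, dirDeriv f₃ p (T₁ p) = 2 * f₂ p)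
    {p q : S3} (hpq : hopf p = hopf q) :
    (differential hopf p (X p) : E3) = differential hopf q (X q) := by
  obtain ⟨θ, rfl⟩ := exists_fibre_of_hopf_eq hpq
  have hd := hasDerivAt_fibre (isSmooth_differential_field hf₂ hf₃ hX) p
  have h0 : ∀ q, dirDeriv (fun p => (differential hopf p (X p) : E3)) q (T₁ q) = 0 := fun q => by
    rw [dirDeriv_differential_field hf₂ hf₃ hX, h₂, h₃]
    simp
  have := is_const_of_deriv_eq_zero (fun t => (hd t).differentiableAt)
    (fun t => by rw [(hd t).deriv, h0]) 0 θ
  exact (congrArg (fun q => (differential hopf q (X q) : E3)) (fibre_zero p)).symm.trans this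

/-! ### Local sections and descent of smooth maps to the two-sphere -/

theorem eq_retract_of_pos_smul {E : Type*} [NormedAddCommGroup E] [InnerProductSpace ℝ E] {s : ℝ}
    (hs : 0 < s) (y : Metric.sphere (0 : E) s) {x : E} (hx : x ≠ 0) {c : ℝ} (hc : 0 < c)
    (h : (y : E) = c • x) : y = retract hs x hx := by
  have hn := norm_coe_sphere y
  rw [h, norm_smul, Real.norm_eq_abs, abs_of_pos hc] at hn
  refine Subtype.ext (h.trans ?_)
  change c • x = (s / ‖x‖) • x
  rw [← hn, mul_div_cancel_right₀ _ (norm_ne_zero_iff.2 hx)]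

theorem normalMap_smul (c : ℝ) (x : E4) : normalMap (c • x) = c ^ 2 • normalMap x := by
  ext i
  fin_cases i <;> simp [normalMap] <;> ring

theorem one_div_sqrt_two_pos : (0 : ℝ) < 1 / √2 := by positivity

theorem hopf_retract {u : E4} (hu : u ≠ 0) {x : E3} (hx : x ≠ 0) {c : ℝ} (hc : 0 < c)
    (h : normalMap u = c • x) :
    hopf (retract sqrt_two_pos u hu) = retract one_div_sqrt_two_pos x hx := by
  have hn := norm_pos_iff.2 hu
  refine eq_retract_of_pos_smul _ _ hx (c := (1 / √2) * ((√2 / ‖u‖) ^ 2 * c)) (by positivity) ?_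
  rw [hopf_coe, retract, normalMap_smul, h, smul_smul, smul_smul, mul_assoc]

/-- A local section of the Hopf map, up to scaling, away from the south pole. -/
def northSection (x : E3) : E4 := !₂[‖x‖ + x 2, 0, x 0, -x 1]

/-- A local section of the Hopf map, up to scaling, away from the north pole. -/
def southSection (x : E3) : E4 := !₂[x 0, x 1, ‖x‖ - x 2, 0]

theorem E3_norm_sq (x : E3) : ‖x‖ ^ 2 = x 0 ^ 2 + x 1 ^ 2 + x 2 ^ 2 := by
  rw [EuclideanSpace.norm_sq_eq]
  simp [Fin.sum_univ_three]

theorem normalMap_northSection (x : E3) : normalMap (northSection x) = (‖x‖ + x 2) • x := by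
  have h := E3_norm_sq x
  ext i
  fin_cases i <;> simp [normalMap, northSection]
  · ring
  · ring
  · linear_combination (1 / 2) * h

theorem normalMap_southSection (x : E3) : normalMap (southSection x) = (‖x‖ - x 2) • x := by
  have h := E3_norm_sq x
  ext i
  fin_cases i <;> simp [normalMap, southSection]
  · ring
  · ring
  · linear_combination -(1 / 2) * h

theorem contDiffAt_northSection {x : E3} (hx : x ≠ 0) : ContDiffAt ℝ ∞ northSection x := by
  have hn : ContDiffAt ℝ ∞ (fun y : E3 => ‖y‖) x := contDiffAt_norm ℝ hx
  refine contDiffAt_euclidean.2 fun i => ?_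
  fin_cases i <;> simp [northSection] <;> fun_prop

theorem contDiffAt_southSection {x : E3} (hx : x ≠ 0) : ContDiffAt ℝ ∞ southSection x := by
  have hn : ContDiffAt ℝ ∞ (fun y : E3 => ‖y‖) x := contDiffAt_norm ℝ hx
  refine contDiffAt_euclidean.2 fun i => ?_
  fin_cases i <;> simp [southSection] <;> fun_prop

/-- Every nonzero vector lies on the ray of an image under `normalMap`, locally smoothly. -/
theorem exists_local_section {x : E3} (hx : x ≠ 0) :
    ∃ S : E3 → E4, ContDiffAt ℝ ∞ S x ∧
      ∀ᶠ y in nhds x, S y ≠ 0 ∧ ∃ c : ℝ, 0 < c ∧ normalMap (S y) = c • y := by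
  have hne : ∀ {u : E4} {y : E3} {c : ℝ}, y ≠ 0 → 0 < c → normalMap u = c • y → u ≠ 0 := by
    rintro u y c hy hc h rfl
    have h0 : normalMap 0 = 0 := by simpa using normalMap_smul 0 0
    rw [h0] at h
    exact smul_ne_zero hc.ne' hy h.symm
  have hev : ∀ᶠ y in nhds x, y ≠ 0 := continuousAt_id.eventually_ne hx
  have hc2 : Continuous fun y : E3 => y 2 := by fun_prop
  -- The factors `‖x‖ + x 2` and `‖x‖ - x 2` add up to `2‖x‖ > 0`, so at least one section is
  -- available at `x`.
  rcases lt_or_ge 0 (‖x‖ + x 2) with h | h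
  · refine ⟨northSection, contDiffAt_northSection hx, ?_⟩
    filter_upwards [hev, (continuous_norm.add hc2).continuousAt.eventually_const_lt h] with y hy hp
    exact ⟨hne hy hp (normalMap_northSection y), _, hp, normalMap_northSection y⟩
  · have h' : 0 < ‖x‖ - x 2 := by linarith [norm_pos_iff.2 hx]
    refine ⟨southSection, contDiffAt_southSection hx, ?_⟩
    filter_upwards [hev, (continuous_norm.sub hc2).continuousAt.eventually_const_lt h'] with y hy hp
    exact ⟨hne hy hp (normalMap_southSection y), _, hp, normalMap_southSection y⟩

theorem hopf_surjective : Function.Surjective hopf := by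
  intro y
  have hy := sphere_ne_zero one_div_sqrt_two_pos y
  obtain ⟨S, -, hS⟩ := exists_local_section hy
  obtain ⟨hne, c, hc, h⟩ := hS.self_of_nhds
  refine ⟨retract sqrt_two_pos _ hne, (hopf_retract hne hy hc h).trans ?_⟩
  exact (eq_retract_of_pos_smul one_div_sqrt_two_pos y hy one_pos (one_smul _ _).symm).symm

/-- A smooth map that is constant on the fibres of the Hopf map descends to a smooth map. -/
theorem isSmooth_of_comp_hopf {G : Type*} [NormedAddCommGroup G] [NormedSpace ℝ G] {V : S3 → G}
    (hV : IsSmooth V) {Y : S2 → G} (hY : ∀ p, V p = Y (hopf p)) : IsSmooth Y := by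
  intro x hx
  have hx0 : x ≠ 0 := hx
  obtain ⟨S, hS, hev⟩ := exists_local_section hx0
  refine ContDiffAt.contDiffWithinAt ?_
  have h1 : ContDiffAt ℝ ∞ (fun y => radialExt V (S y)) x :=
    (hV.contDiffAt hev.self_of_nhds.1).comp x hS
  refine h1.congr_of_eventuallyEq ?_
  filter_upwards [hev, isOpen_compl_singleton.mem_nhds hx] with y hy (hy0 : y ≠ 0)
  obtain ⟨hne, c, hc, h⟩ := hy
  -- Near `x` the extension of `Y` is the extension of `V` composed with the local section; the
  -- section need only be right up to positive scaling, because both extensions are constant on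
  -- rays.
  rw [radialExt_eq one_div_sqrt_two_pos Y y hy0, radialExt_eq sqrt_two_pos V _ hne, hY,
    hopf_retract hne hy0 hc h]

/-- Expanding `v ∈ ker dψ` in the frame, the independence of `V₂` and `V₃` kills its components
along `X₂` and `X₃`. -/
theorem mem_horizontalSpace (hX : ∀ p, X p = f₂ p • X₂ p + f₃ p • X₃ p) (p : S3) :
    X p ∈ horizontalSpace hopf p := by
  rw [horizontalSpace, Submodule.mem_orthogonal]
  intro v hv
  rw [LinearMap.mem_ker] at hv
  have h := (frame p).sum_repr' v
  simp only [Fin.sum_univ_three, frame_apply, frameT, Matrix.cons_val] at h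
  rw [← X₂_eq, ← X₃_eq] at h
  have h1 : inner ℝ (X₂ p) v • V₂ p + inner ℝ (X₃ p) v • V₃ p = 0 := by
    rw [← hv]
    conv_rhs => rw [← h]
    simp only [map_add, map_smul, differential_hopf_T₁, smul_zero, zero_add]
    rfl
  obtain ⟨a, b⟩ := combination_V_eq_zero h1
  rw [hX, inner_add_right, inner_smul_right, inner_smul_right, real_inner_comm, a,
    real_inner_comm, b]
  simp

theorem isSmooth_X₂ : IsSmooth fun q : S3 => (X₂ q : E4) := by
  refine isSmooth_restrict sqrt_two_pos
    (g := fun x : E4 => (1 / √2) • (!₂[-x 2, x 3, x 0, -x 1] : E4)) (fun _ => rfl)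
    (ContDiff.contDiffOn (contDiff_euclidean.2 fun i => ?_))
  fin_cases i <;> simp <;> fun_prop

theorem isSmooth_X₃ : IsSmooth fun q : S3 => (X₃ q : E4) := by
  refine isSmooth_restrict sqrt_two_pos
    (g := fun x : E4 => (1 / √2) • (!₂[-x 3, -x 2, x 1, x 0] : E4)) (fun _ => rfl)
    (ContDiff.contDiffOn (contDiff_euclidean.2 fun i => ?_))
  fin_cases i <;> simp <;> fun_prop

theorem isSmooth_field (hf₂ : IsSmooth f₂) (hf₃ : IsSmooth f₃)
    (hX : ∀ p, X p = f₂ p • X₂ p + f₃ p • X₃ p) : IsSmooth fun q => (X q : E4) := by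
  have h : (fun q => (X q : E4)) = fun q => f₂ q • (X₂ q : E4) + f₃ q • (X₃ q : E4) :=
    funext fun q => by rw [hX]; rfl
  rw [h]
  exact (hf₂.smul isSmooth_X₂).add (hf₃.smul isSmooth_X₃)

theorem isBasic_of_rotation (hf₂ : IsSmooth f₂) (hf₃ : IsSmooth f₃)
    (hX : ∀ p, X p = f₂ p • X₂ p + f₃ p • X₃ p)
    (h₂ : ∀ p, dirDeriv f₂ p (T₁ p) = -(2 * f₃ p)) (h₃ : ∀ p, dirDeriv f₃ p (T₁ p) = 2 * f₂ p) :
    IsBasic hopf X := by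
  -- An arbitrary set-theoretic section suffices: `dψ(X)` is constant on fibres, so `Y` does not
  -- depend on the choice, and its smoothness comes from the local sections.
  let σ := Function.surjInv hopf_surjective
  have hσ : ∀ y, hopf (σ y) = y := Function.surjInv_eq hopf_surjective
  let Y : ∀ y : S2, Tan y := fun y => ⟨differential hopf (σ y) (X (σ y)), by
    have h : (differential hopf (σ y) (X (σ y)) : E3) ∈ Tan (hopf (σ y)) := Subtype.prop _
    generalize (differential hopf (σ y) (X (σ y)) : E3) = v at h ⊢
    rwa [hσ] at h⟩
  have hY : ∀ p, (differential hopf p (X p) : E3) = Y (hopf p) := fun p =>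
    differential_eq_of_hopf_eq hf₂ hf₃ hX h₂ h₃ (hσ (hopf p)).symm
  exact ⟨isSmooth_field hf₂ hf₃ hX, mem_horizontalSpace hX, Y,
    isSmooth_of_comp_hopf (isSmooth_differential_field hf₂ hf₃ hX) hY,
    fun p => Subtype.ext (hY p)⟩

end Basic

end HopfJacobi
end

/-! ### The equivalence -/

theorem proposition4p7 (k : ℕ) (f₂ f₃ : HopfJacobi.S3 → ℝ)
    (hf₂ : HopfJacobi.IsSmooth f₂) (hf₃ : HopfJacobi.IsSmooth f₃)
    (he₂ : ∀ p, HopfJacobi.laplacian f₂ p = HopfJacobi.eigenvalue k * f₂ p)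
    (he₃ : ∀ p, HopfJacobi.laplacian f₃ p = HopfJacobi.eigenvalue k * f₃ p)
    (X : ∀ p : HopfJacobi.S3, HopfJacobi.Tan p)
    (hX : ∀ p, X p = f₂ p • HopfJacobi.X₂ p + f₃ p • HopfJacobi.X₃ p)
    (hX0 : X ≠ 0) :
    (fun p => HopfJacobi.differential HopfJacobi.hopf p (X p))
        ∈ HopfJacobi.jacobiKernel HopfJacobi.hopf ↔
      k = 0 ∨ (k = 2 ∧ HopfJacobi.IsBasic HopfJacobi.hopf X) := by
  open HopfJacobi in
  rw [mem_jacobiKernel_iff hf₂ hf₃ hX he₂ he₃]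
  constructor
  · intro h
    have h₂ := fun p => (h p).1
    have h₃ := fun p => (h p).2
    obtain ⟨p, hp⟩ : ∃ p, ¬(f₂ p = 0 ∧ f₃ p = 0) := by
      by_contra! hc
      refine hX0 (funext fun p => ?_)
      have h2 : f₂ p = 0 := (hc p).1
      have h3 : f₃ p = 0 := (hc p).2
      rw [hX, h2, h3, zero_smul, zero_smul, add_zero]
      rfl
    obtain ⟨n, hn⟩ := exists_int_of_rotation hf₂ hf₃ h₂ h₃ hp
    -- Integrality of `μ = k(k+2)/4`; it rules out `k = 1` and `k = 3`, where `k(k+2)` is `3` and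
    -- `15`.
    have hn4 : ((k * (k + 2) : ℤ)) = 4 * n := by
      have : ((k : ℝ) * (k + 2)) = 4 * n := by rw [← hn, eigenvalue]; ring
      exact_mod_cast this
    rcases lt_or_ge k 4 with hk | hk
    · interval_cases k
      · exact Or.inl rfl
      · omega
      · refine Or.inr ⟨rfl, isBasic_of_rotation hf₂ hf₃ hX (fun p => ?_) fun p => ?_⟩
        · rw [h₂, eigenvalue]; norm_num
        · rw [h₃, eigenvalue]; norm_num
      · omega
    · exfalso
      set μ := eigenvalue k / 2 with hμ
      have hk' : (4 : ℝ) ≤ k := by exact_mod_cast hk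
      have hμ4 : 4 < μ := by rw [hμ, eigenvalue]; nlinarith
      -- The eigenvalue of `T₂² + T₃²`: the full trace is `-2λ = -4μ` and `T₁²` accounts for `-μ²`.
      have hc : 0 < μ ^ 2 - 4 * μ := by nlinarith
      have hev : ∀ {f : S3 → ℝ}, IsSmooth f → (∀ p, laplacian f p = eigenvalue k * f p) →
          (∀ p, tanHess f p (T₁ p) (T₁ p) = -(μ * (μ * f p))) → ∀ p, f p = 0 := by
        intro f hf he h1
        refine eq_zero_of_horizontal hf hc fun p => ?_
        have := laplacian_frame hf p
        rw [he, h1] at this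
        linear_combination this + 4 * f p * hμ
      -- Exchanging the two functions reverses the sense of rotation, hence the frequency `-μ`.
      have ht₃ := tanHess_T₁_of_rotation hf₃ hf₂ (μ := -μ) (fun p => by rw [h₃]; ring)
        (fun p => by rw [h₂]; ring)
      exact hp ⟨hev hf₂ he₂ (tanHess_T₁_of_rotation hf₂ hf₃ h₂ h₃) p,
        hev hf₃ he₃ (fun p => by rw [ht₃]; ring) p⟩
  · rintro (rfl | ⟨rfl, hb⟩) p
    · have h0 : eigenvalue 0 = 0 := by simp [eigenvalue]
      rw [dirDeriv_eq_zero_of_harmonic hf₂ (fun q => by rw [he₂, h0, zero_mul]),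
        dirDeriv_eq_zero_of_harmonic hf₃ (fun q => by rw [he₃, h0, zero_mul]), h0]
      constructor <;> ring
    · obtain ⟨a, b⟩ := rotation_of_isBasic hf₂ hf₃ hX hb p
      rw [a, b, eigenvalue]
      constructor <;> norm_num
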